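/- **Setting.** Let $c>0$, $\alpha>0$, $\alpha\neq1$, and consider $N$ users. User $k$ has parameters $a_k>0$, $\gamma_k\in[0,1]$, $b_k\in(0,1)$ with $2-\alpha-\gamma_k\ne0$, and an initial state $x_k(0)>0$. Its state grows according to $\dot x_k=a_kx_k^{\gamma_k}$, and an impulse at time $t$ changes it to $x_k(t+0)=b_kx_k(t)$. A deterministic policy of a user is a nondecreasing sequence of impulse times $T_1\le T_2\le\dots$ in $[0,\infty]$ with $T_n\to\infty$ (several impulses at the same time are allowed). A mixed policy $(\beta,T,S)$, $\beta\in[0,1]$, follows $T$ with probability $\beta$ and $S$ with probability $1-\beta$. Let $\mathcal U$ be the set of vectors $u=(u_1,\dots,u_N)$ of mixed policies. Define, with values in $[-\infty,\infty]$, $$J_k(u_k)=\liminf_{\tau\to\infty}\frac1\tau E^{u_k}\Big[\int_0^\tau\frac{x_k(t)^{1-\alpha}}{1-\alpha}\,dt\Big],\qquad G_k(u_k)=\limsup_{\tau\to\infty}\frac1\tau E^{u_k}\Big[\int_0^\tau x_k(t)\,dt\Big].$$ The problem is $$J(u)=\sum_{k=1}^NJ_k(u_k)\to\sup_{u\in\mathcal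 U}\quad\text{subject to}\quad G(u)=\sum_{k=1}^NG_k(u_k)\le c.\tag{P}$$ For $\lambda>0$ put $$\bar x_k(\lambda)=\left\{\frac{(2-\gamma_k)(1-b_k^{2-\alpha-\gamma_k})}{(1-b_k^{2-\gamma_k})(2-\alpha-\gamma_k)\lambda}\right\}^{1/\alpha},$$ and consider the threshold policy of user $k$ which applies an impulse as soon as $x_k(t)\ge\bar x_k(\lambda)$. It induces a deterministic policy $u_k^{(\lambda)}$, and $J_k(u_k^{(\lambda)})$, $G_k(u_k^{(\lambda)})$ are finite. Let $\Omega_k\subset\mathbb R^2$ be the convex hull of the curve $\{(-J_k(u_k^{(\lambda)}),G_k(u_k^{(\lambda)})):\lambda>0\}$, and let $\Omega=\prod_{k=1}^N\Omega_k\subset\mathbb R^{2N}$. For $\omega=((\omega_k^1,\omega_k^2))_{k=1}^N\in\Omega$ let $-\tilde J(\omega)=\sum_k\omega_k^1$ and $\tilde G(\omega)=\sum_k\omega_k^2$. The reformulated problem in performance space is to minimize $-\tilde J(\omega)$ over $\omega\in\Omega$ subject to $\tilde G(\omega)-c\le0$. **Theorem.** (a) The set $\Omega$ is convex, and the functions $-\tilde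 J$ and $\tilde G$ on $\Omega$ are convex and real-valued. (b) There exists $\hat\omega\in\Omega$ with $\tilde G(\hat\omega)<c$ (Slater's condition). (c) For each $k$ the threshold $\bar x_k(\lambda^*)$ induces a unique deterministic policy $u_k^*$, and $u^*=(u_1^*,\dots,u_N^*)$ is optimal for (P), where $$\lambda^*=\frac1{c^\alpha}\Bigg(\sum_{k:\gamma_k\ne1}\frac{1-\gamma_k}{2-\gamma_k}\,\frac{1-b_k^{2-\gamma_k}}{1-b_k^{1-\gamma_k}}\Big(\frac{2-\gamma_k}{1-b_k^{2-\gamma_k}}\Big)^{1/\alpha}\Big(\frac{1-b_k^{2-\alpha-\gamma_k}}{2-\alpha-\gamma_k}\Big)^{1/\alpha}+\sum_{k:\gamma_k=1}\Big(\frac{1-b_k^{1-\alpha}}{1-\alpha}\Big)^{1/\alpha}\frac{(1-b_k)^{(\alpha-1)/\alpha}}{-\ln b_k}\Bigg)^{\alpha}.$$ In the homogeneous case ($\gamma_k=\gamma$ and $b_k=b$ for all $k$): if $\gamma\ne1$, then $$\lambda^*=\frac{N^\alpha}{c^\alpha}\,\frac{(1-\gamma)^\alpha}{(1-b^{1-\gamma})^\alpha}\,\frac{(1-b^{2-\gamma})^\alpha}{(2-\gamma)^\alpha}\,\frac{2-\gamma}{1-b^{2-\gamma}}\,\frac{1-b^{2-\alpha-\gamma}}{2-\alpha-\gamma},\qquad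 \bar x_k(\lambda^*)=\frac cN\,\frac{1-b^{1-\gamma}}{1-\gamma}\,\frac{2-\gamma}{1-b^{2-\gamma}};$$ if $\gamma=1$, then $$\lambda^*=\frac1{c^\alpha}\left(N\Big(\frac{1-b^{1-\alpha}}{(1-b)(1-\alpha)}\Big)^{1/\alpha}\,\frac{b-1}{\ln b}\right)^{\alpha}.$$ -/

import Mathlib

open Set Filter Topology
open scoped ENNReal

noncomputable section

namespace GAIMD

/-- A G-AIMD user: growth `dx/dt = a x ^ γ`, impulse `x ↦ b x`, initial state `x₀`. -/
structure User where
  a : ℝ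
  γ : ℝ
  b : ℝ
  x₀ : ℝ
  a_pos : 0 < a
  γ_mem : γ ∈ Icc (0 : ℝ) 1
  b_mem : b ∈ Ioo (0 : ℝ) 1
  x₀_pos : 0 < x₀

/-- A (deterministic) policy of one user: a nondecreasing sequence of impulse times in `[0, ∞]`
tending to `∞`; equal entries are multiple impulses at one time moment. -/
@[ext] structure Policy where
  time : ℕ → ℝ≥0∞
  mono : Monotone time
  tendsto_top : Tendsto time atTop (𝓝 ⊤)

/-- A mixed policy `(β, T, S)`: `T` with probability `β`, and `S` with probability `1 - β`. -/
structure MixedPolicy where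
  β : ℝ
  β_mem : β ∈ Icc (0 : ℝ) 1
  T : Policy
  S : Policy

/-- A deterministic policy, as the mixture `(1, T, T)`. -/
def Policy.toMixed (T : Policy) : MixedPolicy := ⟨1, ⟨zero_le_one, le_rfl⟩, T, T⟩

/-- The expectation of a functional of the realized deterministic policy. -/
def MixedPolicy.expect (u : MixedPolicy) (F : Policy → ℝ) : ℝ :=
  u.β * F u.T + (1 - u.β) * F u.S

/-- The time at which the `n`-th inter-impulse period starts: `0` for `n = 0`, and the time of the
`n`-th impulse for `n ≥ 1`. (Periods that start at time `∞` are never reached.) -/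
def Policy.start (T : Policy) : ℕ → ℝ
  | 0 => 0
  | n + 1 => (T.time n).toReal

/-- The number of impulses strictly before time `t`. -/
def Policy.count (T : Policy) (t : ℝ) : ℕ := sInf {n | ENNReal.ofReal t ≤ T.time n}

/-- The state after time `t` of uncontrolled growth from the state `y`; see `User.flow_zero` and
`User.hasDerivAt_flow`. -/
def User.flow (U : User) (y t : ℝ) : ℝ :=
  if U.γ = 1 then y * Real.exp (U.a * t)
  else (y ^ (1 - U.γ) + (1 - U.γ) * U.a * t) ^ (1 / (1 - U.γ))

/-- The state right after the first `n` impulses of `T` (the initial state for `n = 0`). -/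
def User.post (U : User) (T : Policy) : ℕ → ℝ
  | 0 => U.x₀
  | n + 1 => U.b * U.flow (U.post T n) (T.start (n + 1) - T.start n)

/-- The state at a time `t ≥ T.start n` if only the first `n` impulses of `T` are applied. -/
def User.stateAfter (U : User) (T : Policy) (n : ℕ) (t : ℝ) : ℝ :=
  U.flow (U.post T n) (t - T.start n)

/-- The trajectory `x(t)`, `t ≥ 0`, under the policy `T`; see `User.isTrajectory_path`. -/
def User.path (U : User) (T : Policy) (t : ℝ) : ℝ := U.stateAfter T (T.count t) t

/-- The controlled dynamics. An impulse at time `t` acts through `x(t+0) = b x(t)`. -/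
structure User.IsTrajectory (U : User) (T : Policy) (x : ℝ → ℝ) : Prop where
  init : x 0 = U.x₀
  left_cont : ∀ t, 0 < t → ContinuousWithinAt x (Iic t) t
  growth : ∀ t, 0 < t → (∀ i, T.time i ≠ ENNReal.ofReal t) → HasDerivAt x (U.a * x t ^ U.γ) t
  impulse : ∀ t, 0 ≤ t →
    Tendsto x (𝓝[>] t) (𝓝 (U.b ^ {i | T.time i = ENNReal.ofReal t}.ncard * x t))

theorem User.flow_zero (U : User) {y : ℝ} (hy : 0 < y) : U.flow y 0 = y := by
  unfold User.flow
  split_ifs with h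
  · simp
  · have h1 : 1 - U.γ ≠ 0 := sub_ne_zero.2 (Ne.symm h)
    rw [mul_zero, add_zero, ← Real.rpow_mul hy.le, mul_one_div_cancel h1, Real.rpow_one]

theorem User.flow_pos (U : User) {y t : ℝ} (hy : 0 < y) (ht : 0 ≤ t) : 0 < U.flow y t := by
  unfold User.flow
  split_ifs with h
  · positivity
  · have h1 : 0 ≤ 1 - U.γ := sub_nonneg.2 U.γ_mem.2
    have := U.a_pos
    positivity

theorem User.hasDerivAt_flow (U : User) {y t : ℝ} (hy : 0 < y) (ht : 0 ≤ t) :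
    HasDerivAt (U.flow y) (U.a * U.flow y t ^ U.γ) t := by
  by_cases h : U.γ = 1
  · have e : U.flow y = fun t => y * Real.exp (U.a * t) := by
      funext s; simp [User.flow, h]
    rw [e, h, Real.rpow_one]
    have h1 : HasDerivAt (fun s : ℝ => U.a * s) U.a t := by
      simpa using (hasDerivAt_id t).const_mul U.a
    have := (h1.exp).const_mul y
    exact this.congr_deriv (by ring)
  · have h0 : 1 - U.γ ≠ 0 := sub_ne_zero.2 (Ne.symm h)
    have h1 : 0 ≤ 1 - U.γ := sub_nonneg.2 U.γ_mem.2
    have ha := U.a_pos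
    have e : U.flow y
        = fun t => (y ^ (1 - U.γ) + (1 - U.γ) * U.a * t) ^ (1 / (1 - U.γ)) := by
      funext s; simp [User.flow, h]
    have hB : 0 < y ^ (1 - U.γ) + (1 - U.γ) * U.a * t := by positivity
    rw [e]
    have hd : HasDerivAt (fun s : ℝ => y ^ (1 - U.γ) + (1 - U.γ) * U.a * s)
        ((1 - U.γ) * U.a) t := by
      simpa using ((hasDerivAt_id t).const_mul ((1 - U.γ) * U.a)).const_add (y ^ (1 - U.γ))
    have := hd.rpow_const (p := 1 / (1 - U.γ)) (Or.inl hB.ne')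
    have e2 : 1 / (1 - U.γ) * U.γ = 1 / (1 - U.γ) - 1 := by field_simp; ring
    refine this.congr_deriv ?_
    simp only []
    rw [← Real.rpow_mul hB.le, e2]
    field_simp

theorem Policy.time_ge_iff (T : Policy) (t : ℝ) (n : ℕ) :
    ENNReal.ofReal t ≤ T.time n ↔ T.count t ≤ n := by
  have hne : {n | ENNReal.ofReal t ≤ T.time n}.Nonempty := by
    have := T.tendsto_top.eventually (Ioi_mem_nhds (ENNReal.ofReal_lt_top (r := t)))
    obtain ⟨n, hn⟩ := this.exists
    exact ⟨n, le_of_lt hn⟩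
  constructor
  · intro h; exact Nat.sInf_le h
  · intro h; exact le_trans (Nat.sInf_mem hne) (T.mono h)

theorem Policy.time_lt_iff (T : Policy) (t : ℝ) (n : ℕ) :
    T.time n < ENNReal.ofReal t ↔ n < T.count t := by
  rw [← not_le, T.time_ge_iff, not_le]

theorem Policy.count_eq (T : Policy) (t : ℝ) (n : ℕ) (h1 : ∀ i < n, T.time i < ENNReal.ofReal t)
    (h2 : ENNReal.ofReal t ≤ T.time n) : T.count t = n := by
  refine le_antisymm ((T.time_ge_iff t n).1 h2) ?_
  by_contra! h
  exact lt_irrefl _ ((T.time_lt_iff t _).1 (h1 _ h))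

theorem Policy.start_le_of_time_le (T : Policy) {t : ℝ} (ht : 0 ≤ t) {n : ℕ}
    (h : ∀ i < n, T.time i ≤ ENNReal.ofReal t) : T.start n ≤ t := by
  cases n with
  | zero => exact ht
  | succ m => exact ENNReal.toReal_le_of_le_ofReal ht (h m (Nat.lt_succ_self m))

theorem Policy.start_mono (T : Policy) {n : ℕ} (h : T.time n ≠ ⊤) :
    T.start n ≤ T.start (n + 1) := by
  cases n with
  | zero => exact ENNReal.toReal_nonneg
  | succ m => exact ENNReal.toReal_mono h (T.mono (Nat.le_succ m))

theorem User.post_pos (U : User) (T : Policy) {n : ℕ} (h : ∀ i < n, T.time i ≠ ⊤) :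
    0 < U.post T n := by
  induction n with
  | zero => exact U.x₀_pos
  | succ m ih =>
    refine mul_pos U.b_mem.1 (U.flow_pos (ih fun i hi => h i (by omega)) ?_)
    exact sub_nonneg.2 (T.start_mono (h m (by omega)))

theorem User.hasDerivAt_stateAfter (U : User) (T : Policy) {n : ℕ} {t : ℝ} (ht : 0 ≤ t)
    (h : ∀ i < n, T.time i ≤ ENNReal.ofReal t) :
    HasDerivAt (U.stateAfter T n) (U.a * U.stateAfter T n t ^ U.γ) t := by
  have hp : 0 < U.post T n :=
    U.post_pos T fun i hi => ((h i hi).trans_lt ENNReal.ofReal_lt_top).ne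
  have := U.hasDerivAt_flow hp (sub_nonneg.2 (T.start_le_of_time_le ht h))
  exact this.comp_sub_const t (T.start n)

theorem User.stateAfter_add (U : User) (T : Policy) {t : ℝ} (ht : 0 ≤ t) (n j : ℕ)
    (h1 : ∀ i < n, T.time i ≤ ENNReal.ofReal t)
    (h2 : ∀ i, n ≤ i → i < n + j → T.time i = ENNReal.ofReal t) :
    U.stateAfter T (n + j) t = U.b ^ j * U.stateAfter T n t := by
  induction j with
  | zero => simp
  | succ j ih =>
    have hs : T.start (n + j + 1) = t := by
      simp [Policy.start, h2 (n + j) (by omega) (by omega), ht]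
    have hp : 0 < U.post T (n + j + 1) := by
      refine U.post_pos T fun i hi => ?_
      rcases lt_or_ge i n with h | h
      · exact ((h1 i h).trans_lt ENNReal.ofReal_lt_top).ne
      · rw [h2 i h (by omega)]; exact ENNReal.ofReal_ne_top
    calc U.stateAfter T (n + (j + 1)) t
        = U.flow (U.post T (n + j + 1)) 0 := by
          rw [← add_assoc]; unfold User.stateAfter; rw [hs, sub_self]
      _ = U.b * U.stateAfter T (n + j) t := by
          rw [U.flow_zero hp]; unfold User.stateAfter; rw [User.post, hs]
      _ = _ := by rw [ih fun i hi hj => h2 i hi (by omega)]; ring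

/-- The trajectory defined in closed form obeys the controlled dynamics. -/
theorem User.isTrajectory_path (U : User) (T : Policy) : U.IsTrajectory T (U.path T) := by
  have hleft : ∀ t : ℝ, 0 < t → ∀ᶠ s in 𝓝 t, s ≤ t → U.path T s = U.stateAfter T (T.count t) s := by
    intro t ht
    have hc : ∀ᶠ s in 𝓝 t, ∀ i < T.count t, T.time i < ENNReal.ofReal s := by
      refine (finite_lt_nat (T.count t)).eventually_all.2 fun i hi => ?_
      exact ENNReal.continuous_ofReal.continuousAt.eventually
        (Ioi_mem_nhds ((T.time_lt_iff t i).2 hi))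
    filter_upwards [hc] with s hs hst
    have : T.count s = T.count t := T.count_eq s _ hs
      ((ENNReal.ofReal_le_ofReal hst).trans ((T.time_ge_iff t _).2 le_rfl))
    simp [User.path, this]
  have hcount : ∀ t : ℝ, ∀ i < T.count t, T.time i ≤ ENNReal.ofReal t :=
    fun t i hi => ((T.time_lt_iff t i).2 hi).le
  have hex : ∀ t : ℝ, ∃ K, (∀ i, T.time i ≤ ENNReal.ofReal t ↔ i < K) := by
    intro t
    have := T.tendsto_top.eventually (Ioi_mem_nhds (ENNReal.ofReal_lt_top (r := t)))
    classical
    refine ⟨Nat.find this.exists, fun i => ⟨fun h => ?_, fun h => ?_⟩⟩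
    · by_contra! hi
      have h3 : ENNReal.ofReal t < T.time (Nat.find this.exists) := Nat.find_spec this.exists
      exact absurd (h3.trans_le (T.mono hi)) (not_lt.2 h)
    · have h3 := Nat.find_min this.exists h
      simpa using h3
  have hright : ∀ t : ℝ, 0 ≤ t → ∀ K, (∀ i, T.time i ≤ ENNReal.ofReal t ↔ i < K) →
      ∀ᶠ s in 𝓝 t, t < s → U.path T s = U.stateAfter T K s := by
    intro t ht K hK
    have h1 : ENNReal.ofReal t < T.time K := by
      rw [← not_le, hK]; exact lt_irrefl _
    filter_upwards [ENNReal.continuous_ofReal.continuousAt.eventually (Iio_mem_nhds h1)]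
      with s hs hts
    have : T.count s = K := T.count_eq s _ (fun i hi => ((hK i).2 hi).trans_lt
      ((ENNReal.ofReal_lt_ofReal_iff (ht.trans_lt hts)).2 hts)) (le_of_lt hs)
    simp [User.path, this]
  refine ⟨?_, ?_, ?_, ?_⟩
  · have : T.count 0 = 0 := T.count_eq 0 0 (by simp) (by simp)
    simp [User.path, this, User.stateAfter, Policy.start, User.post, U.flow_zero U.x₀_pos]
  · intro t ht
    have hc := (U.hasDerivAt_stateAfter T ht.le (hcount t)).continuousAt.continuousWithinAt
      (s := Iic t)
    refine hc.congr_of_eventuallyEq ?_ rfl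
    filter_upwards [nhdsWithin_le_nhds (hleft t ht), self_mem_nhdsWithin] with s h1 h2
    exact h1 h2
  · intro t ht hne
    have hK : ∀ i, T.time i ≤ ENNReal.ofReal t ↔ i < T.count t := fun i => by
      rw [← T.time_lt_iff]
      exact ⟨fun h => lt_of_le_of_ne h (hne i), le_of_lt⟩
    have hd := U.hasDerivAt_stateAfter T ht.le (hcount t)
    refine hd.congr_of_eventuallyEq ?_
    filter_upwards [hleft t ht, hright t ht.le _ hK] with s h1 h2
    rcases le_or_gt s t with h | h
    · exact h1 h
    · exact h2 h
  · intro t ht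
    obtain ⟨K, hK⟩ := hex t
    have hle : T.count t ≤ K := by
      by_contra! h
      exact lt_irrefl _ ((hK K).1 (hcount t K h))
    have hset : {i | T.time i = ENNReal.ofReal t} = (Finset.Ico (T.count t) K : Set ℕ) := by
      ext i
      simp only [mem_ofPred_eq, Finset.coe_Ico, mem_Ico]
      rw [← hK, ← T.time_ge_iff]
      exact ⟨fun h => ⟨h.ge, h.le⟩, fun h => le_antisymm h.2 h.1⟩
    have hadd := U.stateAfter_add T ht (T.count t) (K - T.count t) (hcount t) (fun i h1 h2 =>
      le_antisymm ((hK i).2 (by omega)) ((T.time_ge_iff t i).2 h1))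
    rw [Nat.add_sub_cancel' hle] at hadd
    have hval : U.b ^ {i | T.time i = ENNReal.ofReal t}.ncard * U.path T t
        = U.stateAfter T K t := by
      rw [hset, Set.ncard_coe_finset, Nat.card_Ico, hadd, User.path]
    rw [hval]
    have hc := (U.hasDerivAt_stateAfter T ht fun i hi => (hK i).2 hi).continuousAt.tendsto
    refine (hc.mono_left (nhdsWithin_le_nhds (s := Ioi t))).congr' ?_
    filter_upwards [nhdsWithin_le_nhds (hright t ht K hK), self_mem_nhdsWithin] with s h1 h2
    exact (h1 h2).symm

/-- The short-term `α`-fairness of one user, a lower limit in `[-∞, ∞]`. -/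
def User.J (U : User) (α : ℝ) (u : MixedPolicy) : EReal :=
  liminf (fun τ : ℝ =>
    ((1 / τ * u.expect (fun T => ∫ t in (0 : ℝ)..τ, U.path T t ^ (1 - α) / (1 - α)) : ℝ) : EReal))
    atTop

/-- The time-averaged allocation of one user, an upper limit in `[-∞, ∞]`. -/
def User.G (U : User) (u : MixedPolicy) : EReal :=
  limsup (fun τ : ℝ =>
    ((1 / τ * u.expect (fun T => ∫ t in (0 : ℝ)..τ, U.path T t) : ℝ) : EReal))
    atTop

/-- `T` is induced by the threshold `xbar`: each next impulse is applied at the first moment, not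
earlier than the previous impulse, at which the current state is at least `xbar`. -/
def User.IsThreshold (U : User) (xbar : ℝ) (T : Policy) : Prop :=
  ∀ n, ∃ t : ℝ, IsLeast {t | T.start n ≤ t ∧ xbar ≤ U.stateAfter T n t} t ∧
    T.time n = ENNReal.ofReal t

/-- The threshold as a function of the multiplier `l`. -/
def User.threshold (U : User) (α l : ℝ) : ℝ :=
  ((2 - U.γ) * (1 - U.b ^ (2 - α - U.γ)) / ((1 - U.b ^ (2 - U.γ)) * (2 - α - U.γ) * l)) ^ (1 / α)

/-- The curve of the pairs `(-J, G)` of the threshold policies, `l` ranging over `(0, ∞)`. -/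
def User.graph (U : User) (α : ℝ) : Set (ℝ × ℝ) :=
  {p | ∃ l : ℝ, 0 < l ∧ ∃ T : Policy, U.IsThreshold (U.threshold α l) T ∧
    -U.J α T.toMixed = (p.1 : EReal) ∧ U.G T.toMixed = (p.2 : EReal)}

/-- The set of performance vectors of one user. -/
def User.Ω (U : User) (α : ℝ) : Set (ℝ × ℝ) := convexHull ℝ (U.graph α)

variable {N : ℕ}

/-- The total short-term `α`-fairness. -/
def totalJ (U : Fin N → User) (α : ℝ) (u : Fin N → MixedPolicy) : EReal := ∑ k, (U k).J α (u k)

/-- The total time-averaged allocation. -/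
def totalG (U : Fin N → User) (u : Fin N → MixedPolicy) : EReal := ∑ k, (U k).G (u k)

/-- `u` is optimal for maximizing the total short-term `α`-fairness over all vectors of mixed
policies whose total time-averaged allocation is at most `c`. -/
def IsOptimal (U : Fin N → User) (α c : ℝ) (u : Fin N → MixedPolicy) : Prop :=
  totalG U u ≤ (c : EReal) ∧
    ∀ v : Fin N → MixedPolicy, totalG U v ≤ (c : EReal) → totalJ U α v ≤ totalJ U α u

/-- The product set of performance vectors `((ω_k¹, ω_k²))_k`. -/
def Ω (U : Fin N → User) (α : ℝ) : Set (Fin N → ℝ × ℝ) := Set.univ.pi fun k => (U k).Ω α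

/-- The objective `-J̃` in performance space (to be minimized). -/
def negJtilde (ω : Fin N → ℝ × ℝ) : ℝ := ∑ k, (ω k).1

/-- The constraint function `G̃` in performance space. -/
def Gtilde (ω : Fin N → ℝ × ℝ) : ℝ := ∑ k, (ω k).2

open scoped Classical in
/-- The multiplier `λ*`. -/
def lamStar (U : Fin N → User) (α c : ℝ) : ℝ :=
  1 / c ^ α *
    ((∑ k with (U k).γ ≠ 1,
        (1 - (U k).γ) / (2 - (U k).γ) *
          ((1 - (U k).b ^ (2 - (U k).γ)) / (1 - (U k).b ^ (1 - (U k).γ))) *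
          ((2 - (U k).γ) / (1 - (U k).b ^ (2 - (U k).γ))) ^ (1 / α) *
          ((1 - (U k).b ^ (2 - α - (U k).γ)) / (2 - α - (U k).γ)) ^ (1 / α)) +
      ∑ k with (U k).γ = 1,
        ((1 - (U k).b ^ (1 - α)) / (1 - α)) ^ (1 / α) *
          ((1 - (U k).b) ^ ((α - 1) / α) / (-Real.log (U k).b))) ^ α

end GAIMD

end

/-!
The argument is Lagrangian duality, with a verification potential for each user.

Along the uncontrolled flow, `x ^ q` is the time derivative of the potential
`pot q = powPrim (q + 1 - γ) / a`, a power or a logarithm of the state. An impulse at the state `z`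
lowers this potential by `z ^ (1 - γ) / a * (z ^ q * powGap b (q + 1 - γ))`. Hence the integral of
`x ^ q` over `[0, τ]` equals the increment of the potential plus the sum of the drops at the
impulses (`User.integral_path_eq`).

For a multiplier `l` the running reward is `x ^ (1 - α) / (1 - α) - l * x`. Subtract a constant `g`,
and form the potential of the difference. Its drop at an impulse from `z` is `z ^ (1 - γ) / a` times
a concave function of `z` of the form `A z ^ (1 - α) / (1 - α) - l B z - g D`. The maximum point of
this function is the threshold, and with `g` the average reward of the threshold cycle the maximum
is `0`. So no impulse at any state contributes a positive amount, and the average reward of any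
policy is at most `g`, up to the boundary terms (`User.exists_integral_le`). The boundary term at
`τ` may be unbounded as the state tends to `0`; as the reward is below `g` there, the potential can
be replaced by its minimum with a constant. The resulting bound holds for all horizons at once, so it
passes to mixtures and to the lower and upper limits (`User.J_le`).

Under the threshold policy all impulses but finitely many take place exactly at the threshold `X`,
so the time averages of `x ^ q` converge to `avg X q` (`User.IsThreshold.tendsto_average`). The
bound is then attained. The average allocation of a user is `coef * l ^ (-1 / α)`, and `λ*` is the
multiplier for which these averages sum to `c` (`sum_avg_lamStar`); strong duality
(`isOptimal_of_sum_avg_eq`) gives the optimality. Slater's condition follows by letting `l` tend to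
infinity.
-/

namespace GAIMD

/-! ### Power potentials and the flow -/

/-- A primitive of `z ↦ z ^ (p - 1)` on `(0, ∞)`: `z ^ p / p`, or `log z` if `p = 0`. -/
noncomputable def powPrim (p z : ℝ) : ℝ := if p = 0 then Real.log z else z ^ p / p

/-- The increment of `powPrim p` over `[b, 1]`; it is `(1 - b ^ p) / p`, or `-log b` if `p = 0`. -/
noncomputable def powGap (b p : ℝ) : ℝ := powPrim p 1 - powPrim p b

theorem powGap_zero (b : ℝ) : powGap b 0 = -Real.log b := by simp [powGap, powPrim]

theorem powGap_of_ne {p : ℝ} (b : ℝ) (hp : p ≠ 0) : powGap b p = (1 - b ^ p) / p := by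
  simp [powGap, powPrim, hp, sub_div]

theorem hasDerivAt_powPrim (p : ℝ) {z : ℝ} (hz : 0 < z) :
    HasDerivAt (powPrim p) (z ^ (p - 1)) z := by
  by_cases hp : p = 0
  · subst hp
    have e : powPrim 0 = Real.log := by funext; simp [powPrim]
    rw [e, zero_sub, Real.rpow_neg_one]
    exact Real.hasDerivAt_log hz.ne'
  · have e : powPrim p = fun z => z ^ p / p := by funext; simp [powPrim, hp]
    rw [e]
    exact ((Real.hasDerivAt_rpow_const (Or.inl hz.ne')).div_const p).congr_deriv (by field_simp)

theorem powPrim_sub_powPrim_mul (p : ℝ) {b z : ℝ} (hb : 0 < b) (hz : 0 < z) :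
    powPrim p z - powPrim p (b * z) = z ^ p * powGap b p := by
  by_cases hp : p = 0
  · subst hp
    simp [powPrim, powGap, Real.log_mul hb.ne' hz.ne']
  · simp only [powPrim, powGap, hp, if_false, Real.mul_rpow hb.le hz.le, Real.one_rpow]
    field_simp

theorem powPrim_strictMonoOn (p : ℝ) : StrictMonoOn (powPrim p) (Ioi 0) := by
  refine strictMonoOn_of_deriv_pos (convex_Ioi 0)
    (fun z hz => (hasDerivAt_powPrim p hz).continuousAt.continuousWithinAt) fun z hz => ?_
  rw [interior_Ioi] at hz
  rw [(hasDerivAt_powPrim p hz).deriv]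
  exact Real.rpow_pos_of_pos hz _

theorem powGap_pos (p : ℝ) {b : ℝ} (hb : b ∈ Ioo (0 : ℝ) 1) : 0 < powGap b p :=
  sub_pos.2 (powPrim_strictMonoOn p hb.1 (mem_Ioi.2 one_pos) hb.2)

theorem User.flow_continuousOn (U : User) {y : ℝ} (hy : 0 < y) :
    ContinuousOn (U.flow y) (Ici 0) :=
  fun _ ht => (U.hasDerivAt_flow hy ht).continuousAt.continuousWithinAt

/-- The chain rule along the flow: a potential with derivative `F z / (a z ^ γ)` integrates `F`. -/
theorem User.integral_comp_flow (U : User) {F H : ℝ → ℝ} (hF : ContinuousOn F (Ioi 0))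
    (hH : ∀ z, 0 < z → HasDerivAt H (F z * z ^ (-U.γ) / U.a) z) {y t : ℝ} (hy : 0 < y)
    (ht : 0 ≤ t) : ∫ s in (0 : ℝ)..t, F (U.flow y s) = H (U.flow y t) - H y := by
  have hd : ∀ s ∈ uIcc 0 t, HasDerivAt (fun s => H (U.flow y s)) (F (U.flow y s)) s := by
    intro s hs
    rw [uIcc_of_le ht] at hs
    have hp := U.flow_pos hy hs.1
    refine ((hH _ hp).comp s (U.hasDerivAt_flow hy hs.1)).congr_deriv ?_
    have := U.a_pos
    rw [Real.rpow_neg hp.le]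
    have := Real.rpow_pos_of_pos hp U.γ
    field_simp
  have hc : ContinuousOn (fun s => F (U.flow y s)) (uIcc 0 t) := by
    rw [uIcc_of_le ht]
    exact hF.comp ((U.flow_continuousOn hy).mono Icc_subset_Ici_self)
      fun s hs => U.flow_pos hy hs.1
  rw [intervalIntegral.integral_eq_sub_of_hasDerivAt hd hc.intervalIntegrable, U.flow_zero hy]

/-- The potential of the power `q`: along the flow its time derivative is `x ^ q`, since
`x ^ q / (a x ^ γ)` has the primitive `powPrim (q + 1 - γ) / a`. -/
noncomputable def User.pot (U : User) (q z : ℝ) : ℝ := powPrim (q + 1 - U.γ) z / U.a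

theorem User.hasDerivAt_pot (U : User) (q : ℝ) {z : ℝ} (hz : 0 < z) :
    HasDerivAt (U.pot q) (z ^ q * z ^ (-U.γ) / U.a) z := by
  refine ((hasDerivAt_powPrim _ hz).div_const U.a).congr_deriv ?_
  rw [← Real.rpow_add hz]; ring_nf

theorem User.pot_sub_pot_mul (U : User) (q : ℝ) {z : ℝ} (hz : 0 < z) :
    U.pot q z - U.pot q (U.b * z)
      = z ^ (1 - U.γ) / U.a * (z ^ q * powGap U.b (q + 1 - U.γ)) := by
  rw [User.pot, User.pot, ← sub_div, powPrim_sub_powPrim_mul _ U.b_mem.1 hz, add_sub_assoc,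
    Real.rpow_add hz]
  ring

theorem User.pot_strictMonoOn (U : User) (q : ℝ) : StrictMonoOn (U.pot q) (Ioi 0) :=
  fun _ hx _ hy h => (div_lt_div_iff_of_pos_right U.a_pos).2 (powPrim_strictMonoOn _ hx hy h)

theorem rpow_continuousOn_Ioi (q : ℝ) : ContinuousOn (fun z : ℝ => z ^ q) (Ioi 0) :=
  fun _ hz => (Real.continuousAt_rpow_const _ _ (Or.inl (ne_of_gt hz))).continuousWithinAt

/-- `pot 0` measures time along the flow. -/
theorem User.pot_zero_flow (U : User) {y t : ℝ} (hy : 0 < y) (ht : 0 ≤ t) :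
    U.pot 0 (U.flow y t) = U.pot 0 y + t := by
  have := U.integral_comp_flow (rpow_continuousOn_Ioi 0)
    (fun z hz => U.hasDerivAt_pot 0 hz) hy ht
  simp at this
  linarith

theorem User.le_flow_iff (U : User) {x y t : ℝ} (hx : 0 < x) (hy : 0 < y) (ht : 0 ≤ t) :
    x ≤ U.flow y t ↔ U.pot 0 x - U.pot 0 y ≤ t := by
  rw [← (U.pot_strictMonoOn 0).le_iff_le hx (U.flow_pos hy ht), U.pot_zero_flow hy ht,
    sub_le_iff_le_add']

theorem User.le_flow (U : User) {y t : ℝ} (hy : 0 < y) (ht : 0 ≤ t) : y ≤ U.flow y t :=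
  (U.le_flow_iff hy hy ht).2 (by simpa using ht)

/-! ### The balance of a controlled trajectory -/

/-- The state just before the impulse with index `n`, meaningful only if that impulse takes place at
a finite time. -/
noncomputable def User.pre (U : User) (T : Policy) (n : ℕ) : ℝ :=
  U.stateAfter T n (T.start (n + 1))

theorem User.post_succ (U : User) (T : Policy) (n : ℕ) :
    U.post T (n + 1) = U.b * U.pre T n := rfl

theorem Policy.ofReal_start_succ (T : Policy) {n : ℕ} (h : T.time n ≠ ⊤) :
    ENNReal.ofReal (T.start (n + 1)) = T.time n := ENNReal.ofReal_toReal h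

theorem User.path_eq (U : User) (T : Policy) {n : ℕ} {s : ℝ} (hs : T.start n < s)
    (h : ∀ i < n, T.time i ≠ ⊤) (hn : ENNReal.ofReal s ≤ T.time n) :
    U.path T s = U.stateAfter T n s := by
  have : T.count s = n := by
    refine T.count_eq s n (fun i hi => ?_) hn
    obtain ⟨m, rfl⟩ : ∃ m, n = m + 1 := ⟨n - 1, by omega⟩
    refine (T.mono (Nat.lt_succ_iff.1 hi)).trans_lt ?_
    rw [← T.ofReal_start_succ (h m (Nat.lt_succ_self m))]
    exact (ENNReal.ofReal_lt_ofReal_iff (ENNReal.toReal_nonneg.trans_lt hs)).2 hs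
  rw [User.path, this]

theorem User.integral_period (U : User) {F H : ℝ → ℝ} (hF : ContinuousOn F (Ioi 0))
    (hflow : ∀ y t, 0 < y → 0 ≤ t → ∫ s in (0 : ℝ)..t, F (U.flow y s) ≤ H (U.flow y t) - H y)
    (T : Policy) {n : ℕ} {t : ℝ} (ht : T.start n ≤ t) (h : ∀ i < n, T.time i ≠ ⊤)
    (hn : ENNReal.ofReal t ≤ T.time n) :
    IntervalIntegrable (fun s => F (U.path T s)) MeasureTheory.volume (T.start n) t ∧
      ∫ s in (T.start n)..t, F (U.path T s) ≤ H (U.stateAfter T n t) - H (U.post T n) := by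
  have hp := U.post_pos T h
  have heq : ∀ s ∈ uIoc (T.start n) t, F (U.stateAfter T n s) = F (U.path T s) := by
    intro s hs
    rw [uIoc_of_le ht] at hs
    rw [U.path_eq T hs.1 h ((ENNReal.ofReal_le_ofReal hs.2).trans hn)]
  have hc : ContinuousOn (fun s => F (U.stateAfter T n s)) (uIcc (T.start n) t) := by
    rw [uIcc_of_le ht]
    refine hF.comp ((U.flow_continuousOn hp).comp (by fun_prop) fun s hs => ?_) fun s hs => ?_
    · exact sub_nonneg.2 hs.1
    · exact U.flow_pos hp (sub_nonneg.2 hs.1)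
  refine ⟨hc.intervalIntegrable.congr heq, ?_⟩
  rw [← intervalIntegral.integral_congr_ae (MeasureTheory.ae_of_all _ heq)]
  have := hflow _ _ hp (sub_nonneg.2 ht)
  have e := intervalIntegral.integral_comp_sub_right (a := T.start n) (b := t)
    (fun s => F (U.flow (U.post T n) s)) (T.start n)
  rw [sub_self] at e
  exact e.trans_le this

/-- The balance up to any time in the period with index `n`, by adding up the earlier periods. -/
theorem User.integral_path_le_aux (U : User) {F H : ℝ → ℝ} (hF : ContinuousOn F (Ioi 0))
    (hflow : ∀ y t, 0 < y → 0 ≤ t → ∫ s in (0 : ℝ)..t, F (U.flow y s) ≤ H (U.flow y t) - H y)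
    (T : Policy) (n : ℕ) : ∀ {t : ℝ}, T.start n ≤ t → (∀ i < n, T.time i ≠ ⊤) →
      ENNReal.ofReal t ≤ T.time n →
    IntervalIntegrable (fun s => F (U.path T s)) MeasureTheory.volume 0 t ∧
      ∫ s in (0 : ℝ)..t, F (U.path T s) ≤ H (U.stateAfter T n t) - H U.x₀
        + ∑ i ∈ Finset.range n, (H (U.pre T i) - H (U.b * U.pre T i)) := by
  induction n with
  | zero =>
    intro t ht h hn
    simpa using! U.integral_period hF hflow T ht h hn
  | succ m ih =>
    intro t ht h hn
    obtain ⟨h1, h2⟩ := U.integral_period hF hflow T ht h hn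
    have hm := h m (Nat.lt_succ_self m)
    obtain ⟨h3, h4⟩ := ih (T.start_mono hm) (fun i hi => h i (by omega))
      (T.ofReal_start_succ hm).le
    refine ⟨h3.trans h1, ?_⟩
    rw [← intervalIntegral.integral_add_adjacent_intervals h3 h1, Finset.sum_range_succ]
    rw [U.post_succ] at h2
    change _ ≤ H (U.pre T m) - _ + _ at h4
    linarith

theorem Policy.start_count_le (T : Policy) {t : ℝ} (ht : 0 ≤ t) : T.start (T.count t) ≤ t :=
  T.start_le_of_time_le ht fun i hi => ((T.time_lt_iff t i).2 hi).le

theorem Policy.time_ne_top_of_lt_count (T : Policy) {t : ℝ} {i : ℕ} (hi : i < T.count t) :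
    T.time i ≠ ⊤ := ((T.time_lt_iff t i).2 hi).ne_top

theorem User.path_pos (U : User) (T : Policy) {t : ℝ} (ht : 0 ≤ t) : 0 < U.path T t :=
  U.flow_pos (U.post_pos T fun _ => T.time_ne_top_of_lt_count)
    (sub_nonneg.2 (T.start_count_le ht))

/-- The energy balance of a trajectory: if the potential `H` dominates the integral of `F` along
the uncontrolled flow, the integral of `F` along the controlled trajectory is at most the increment
of `H` plus the amounts that the impulses take away. -/
theorem User.integral_path_le (U : User) {F H : ℝ → ℝ} (hF : ContinuousOn F (Ioi 0))
    (hflow : ∀ y t, 0 < y → 0 ≤ t → ∫ s in (0 : ℝ)..t, F (U.flow y s) ≤ H (U.flow y t) - H y)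
    (T : Policy) {t : ℝ} (ht : 0 ≤ t) :
    ∫ s in (0 : ℝ)..t, F (U.path T s) ≤ H (U.path T t) - H U.x₀
        + ∑ i ∈ Finset.range (T.count t), (H (U.pre T i) - H (U.b * U.pre T i)) :=
  (U.integral_path_le_aux hF hflow T _ (T.start_count_le ht)
    (fun _ => T.time_ne_top_of_lt_count) ((T.time_ge_iff t _).2 le_rfl)).2

theorem User.intervalIntegrable_path (U : User) {F : ℝ → ℝ} (hF : ContinuousOn F (Ioi 0))
    (T : Policy) {t : ℝ} (ht : 0 ≤ t) :
    IntervalIntegrable (fun s => F (U.path T s)) MeasureTheory.volume 0 t := by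
  -- The primitive of `F z / (a z ^ γ)` from `1` is a potential of `F`.
  have hc : ContinuousOn (fun z => F z * z ^ (-U.γ) / U.a) (Ioi 0) :=
    (hF.mul (rpow_continuousOn_Ioi _)).div_const _
  have hH : ∀ z, 0 < z → HasDerivAt (fun z => ∫ w in (1 : ℝ)..z, F w * w ^ (-U.γ) / U.a)
      (F z * z ^ (-U.γ) / U.a) z := fun z hz =>
    intervalIntegral.integral_hasDerivAt_right
      ((hc.mono fun w hw => (lt_min one_pos hz).trans_le hw.1).intervalIntegrable)
      (hc.stronglyMeasurableAtFilter isOpen_Ioi z hz) (hc.continuousAt (Ioi_mem_nhds hz))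
  exact (U.integral_path_le_aux (H := fun z => ∫ w in (1 : ℝ)..z, F w * w ^ (-U.γ) / U.a) hF
    (fun y t hy ht => (U.integral_comp_flow hF hH hy ht).le) T _
    (T.start_count_le ht) (fun _ => T.time_ne_top_of_lt_count) ((T.time_ge_iff t _).2 le_rfl)).1

/-- The energy balance for an exact potential. -/
theorem User.integral_path_eq (U : User) {F H : ℝ → ℝ} (hF : ContinuousOn F (Ioi 0))
    (hH : ∀ z, 0 < z → HasDerivAt H (F z * z ^ (-U.γ) / U.a) z) (T : Policy) {t : ℝ}
    (ht : 0 ≤ t) :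
    ∫ s in (0 : ℝ)..t, F (U.path T s) = H (U.path T t) - H U.x₀
        + ∑ i ∈ Finset.range (T.count t), (H (U.pre T i) - H (U.b * U.pre T i)) := by
  refine le_antisymm (U.integral_path_le hF
    (fun y t hy ht => (U.integral_comp_flow hF hH hy ht).le) T ht) ?_
  have h := U.integral_path_le (F := fun z => -F z) (H := fun z => -H z) hF.fun_neg
    (fun y t hy ht => (U.integral_comp_flow hF.fun_neg
      (fun z hz => ((hH z hz).fun_neg).congr_deriv (by ring)) hy ht).le) T ht
  rw [intervalIntegral.integral_neg] at h
  have e : ∑ i ∈ Finset.range (T.count t), (-H (U.pre T i) - -H (U.b * U.pre T i))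
      = -∑ i ∈ Finset.range (T.count t), (H (U.pre T i) - H (U.b * U.pre T i)) := by
    rw [← Finset.sum_neg_distrib]
    exact Finset.sum_congr rfl fun i _ => by ring
  rw [e] at h
  linarith

/-! ### The Lagrangian bound for an arbitrary policy -/

/-- The tangent-line inequality of the concave function `z ↦ z ^ (1 - α) / (1 - α)`. -/
theorem rpow_div_le_tangent {α : ℝ} (hα : 0 < α) (hα1 : α ≠ 1) {x z : ℝ} (hx : 0 < x)
    (hz : 0 < z) :
    z ^ (1 - α) / (1 - α) ≤ x ^ (1 - α) / (1 - α) + x ^ (-α) * (z - x) := by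
  have key : ∀ s : ℝ, 0 < s → s ^ (1 - α) / (1 - α) ≤ 1 / (1 - α) + (s - 1) := by
    intro s hs
    rcases lt_or_gt_of_ne hα1 with h | h
    · have h1 : 0 < 1 - α := sub_pos.2 h
      have := rpow_one_add_le_one_add_mul_self (s := s - 1) (by linarith) h1.le (by linarith)
      rw [add_sub_cancel] at this
      rw [div_le_iff₀ h1, add_mul, div_mul_cancel₀ _ h1.ne']
      linarith
    · have h1 : 1 - α < 0 := sub_neg.2 h
      have h2 := Real.add_one_le_exp (Real.log s * (1 - α))
      rw [← Real.rpow_def_of_pos hs] at h2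
      have h3 := Real.log_le_sub_one_of_pos hs
      rw [div_le_iff_of_neg h1, add_mul, div_mul_cancel₀ _ h1.ne]
      nlinarith
  have h := mul_le_mul_of_nonneg_left (key (z / x) (div_pos hz hx))
    (Real.rpow_pos_of_pos hx (1 - α)).le
  rw [Real.div_rpow hz.le hx.le] at h
  have hxp := Real.rpow_pos_of_pos hx (1 - α)
  have e : x ^ (-α) = x ^ (1 - α) / x := by
    rw [← Real.rpow_sub_one hx.ne']; ring_nf
  rw [e]
  calc z ^ (1 - α) / (1 - α) = x ^ (1 - α) * (z ^ (1 - α) / x ^ (1 - α) / (1 - α)) := by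
        field_simp
    _ ≤ x ^ (1 - α) * (1 / (1 - α) + (z / x - 1)) := h
    _ = _ := by field_simp

/-- The long-run average of `x ^ q` over the cycle that grows from `b X` to `X`. -/
noncomputable def User.avg (U : User) (X q : ℝ) : ℝ :=
  powGap U.b (q + 1 - U.γ) / powGap U.b (1 - U.γ) * X ^ q

theorem User.powGap_pos (U : User) (p : ℝ) : 0 < powGap U.b p := GAIMD.powGap_pos p U.b_mem

theorem User.threshold_eq (U : User) {α : ℝ} (hαγ : 2 - α - U.γ ≠ 0) (l : ℝ) :
    U.threshold α l
      = (powGap U.b (1 - α + 1 - U.γ) / (powGap U.b (1 + 1 - U.γ) * l)) ^ (1 / α) := by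
  have hb := U.b_mem
  have hγ := U.γ_mem
  have h2 : (2 : ℝ) - U.γ ≠ 0 := by linarith [hγ.2]
  rw [show 1 - α + 1 - U.γ = 2 - α - U.γ by ring, show (1 : ℝ) + 1 - U.γ = 2 - U.γ by ring,
    powGap_of_ne _ h2, powGap_of_ne _ hαγ, User.threshold]
  congr 1
  have h3 := U.powGap_pos (2 - U.γ)
  rw [powGap_of_ne _ h2] at h3
  have h4 : 1 - U.b ^ (2 - U.γ) ≠ 0 := by
    intro h; simp [h] at h3
  by_cases hl : l = 0
  · simp [hl]
  · field_simp

theorem User.threshold_pos (U : User) {α l : ℝ} (hαγ : 2 - α - U.γ ≠ 0) (hl : 0 < l) :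
    0 < U.threshold α l := by
  rw [U.threshold_eq hαγ]
  exact Real.rpow_pos_of_pos (div_pos (U.powGap_pos _) (mul_pos (U.powGap_pos _) hl)) _

/-- The first-order condition that characterizes the threshold. -/
theorem User.mul_powGap_eq (U : User) {α l : ℝ} (hα : 0 < α) (hαγ : 2 - α - U.γ ≠ 0)
    (hl : 0 < l) : l * powGap U.b (1 + 1 - U.γ)
      = powGap U.b (1 - α + 1 - U.γ) * U.threshold α l ^ (-α) := by
  have h1 := U.powGap_pos (1 + 1 - U.γ)
  have h2 := U.powGap_pos (1 - α + 1 - U.γ)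
  rw [U.threshold_eq hαγ, ← Real.rpow_mul (by positivity),
    show 1 / α * -α = -1 by field_simp, Real.rpow_neg_one]
  field_simp

/-- The long-run average of the Lagrangian under the threshold `X`. -/
noncomputable def User.gain (U : User) (α l X : ℝ) : ℝ :=
  U.avg X (1 - α) / (1 - α) - l * U.avg X 1

theorem User.gain_mul (U : User) (α l : ℝ) {X : ℝ} :
    U.gain α l X * powGap U.b (1 - U.γ)
      = powGap U.b (1 - α + 1 - U.γ) * X ^ (1 - α) / (1 - α)
        - l * powGap U.b (1 + 1 - U.γ) * X := by
  have := U.powGap_pos (1 - U.γ)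
  rw [User.gain, User.avg, User.avg, Real.rpow_one]
  field_simp

theorem User.gain_pos (U : User) {α l : ℝ} (hα : 0 < α) (hα1 : α < 1)
    (hαγ : 2 - α - U.γ ≠ 0) (hl : 0 < l) : 0 < U.gain α l (U.threshold α l) := by
  have hX := U.threshold_pos hαγ hl
  refine pos_of_mul_pos_left ?_ (U.powGap_pos (1 - U.γ)).le
  rw [U.gain_mul, U.mul_powGap_eq hα hαγ hl, mul_assoc, ← Real.rpow_add_one hX.ne',
    show -α + 1 = 1 - α by ring]
  have h1 : 0 < 1 - α := sub_pos.2 hα1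
  have h2 := U.powGap_pos (1 - α + 1 - U.γ)
  have h3 := Real.rpow_pos_of_pos hX (1 - α)
  have e : powGap U.b (1 - α + 1 - U.γ) * U.threshold α l ^ (1 - α) / (1 - α)
      - powGap U.b (1 - α + 1 - U.γ) * U.threshold α l ^ (1 - α)
      = powGap U.b (1 - α + 1 - U.γ) * U.threshold α l ^ (1 - α) * α / (1 - α) := by
    field_simp; ring
  rw [e]
  positivity

/-- The potential of the Lagrangian relative to its gain. -/
noncomputable def User.lagPot (U : User) (α l X z : ℝ) : ℝ :=
  U.pot (1 - α) z / (1 - α) - l * U.pot 1 z - U.gain α l X * U.pot 0 z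

theorem User.hasDerivAt_lagPot (U : User) (α l X : ℝ) {z : ℝ} (hz : 0 < z) :
    HasDerivAt (U.lagPot α l X)
      ((z ^ (1 - α) / (1 - α) - l * z - U.gain α l X) * z ^ (-U.γ) / U.a) z := by
  refine ((((U.hasDerivAt_pot (1 - α) hz).div_const (1 - α)).sub
    ((U.hasDerivAt_pot 1 hz).const_mul l)).sub
    ((U.hasDerivAt_pot 0 hz).const_mul (U.gain α l X))).congr_deriv ?_
  rw [Real.rpow_one, Real.rpow_zero]
  ring

/-- No impulse increases the potential: this is where the optimality of the threshold enters. -/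
theorem User.lagPot_le_mul (U : User) {α l : ℝ} (hα : 0 < α) (hα1 : α ≠ 1)
    (hαγ : 2 - α - U.γ ≠ 0) (hl : 0 < l) {z : ℝ} (hz : 0 < z) :
    U.lagPot α l (U.threshold α l) z ≤ U.lagPot α l (U.threshold α l) (U.b * z) := by
  have hX := U.threshold_pos hαγ hl
  have ha := U.a_pos
  have hp1 := U.pot_sub_pot_mul (1 - α) hz
  have hp2 := U.pot_sub_pot_mul 1 hz
  have hp3 := U.pot_sub_pot_mul 0 hz
  rw [Real.rpow_one] at hp2
  rw [Real.rpow_zero, one_mul, zero_add] at hp3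
  have e : U.lagPot α l (U.threshold α l) z - U.lagPot α l (U.threshold α l) (U.b * z)
      = z ^ (1 - U.γ) / U.a * (powGap U.b (1 - α + 1 - U.γ) *
        (z ^ (1 - α) / (1 - α) - (U.threshold α l ^ (1 - α) / (1 - α)
          + U.threshold α l ^ (-α) * (z - U.threshold α l)))) := by
    calc _ = (U.pot (1 - α) z - U.pot (1 - α) (U.b * z)) / (1 - α)
          - l * (U.pot 1 z - U.pot 1 (U.b * z))
          - U.gain α l (U.threshold α l) * (U.pot 0 z - U.pot 0 (U.b * z)) := by
          unfold User.lagPot; ring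
      _ = z ^ (1 - U.γ) / U.a * (z ^ (1 - α) * powGap U.b (1 - α + 1 - U.γ) / (1 - α)
          - l * powGap U.b (1 + 1 - U.γ) * z
          - U.gain α l (U.threshold α l) * powGap U.b (1 - U.γ)) := by
          rw [hp1, hp2, hp3]; ring
      _ = _ := by
          rw [U.gain_mul, U.mul_powGap_eq hα hαγ hl]; ring
  have h1 := rpow_div_le_tangent hα hα1 hX hz
  have h2 : 0 ≤ z ^ (1 - U.γ) / U.a * powGap U.b (1 - α + 1 - U.γ) :=
    mul_nonneg (by positivity) (U.powGap_pos _).le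
  rw [← sub_nonpos, e, ← mul_assoc]
  exact mul_nonpos_of_nonneg_of_nonpos h2 (sub_nonpos.2 h1)

/-- Near `0` the Lagrangian is below its gain. -/
theorem User.exists_lagrangian_nonpos_near_zero (U : User) {α l : ℝ} (hα : 0 < α) (hα1 : α ≠ 1)
    (hαγ : 2 - α - U.γ ≠ 0) (hl : 0 < l) :
    ∃ m, 0 < m ∧ ∀ z, 0 < z → z ≤ m →
      z ^ (1 - α) / (1 - α) - l * z - U.gain α l (U.threshold α l) ≤ 0 := by
  have hev : ∀ᶠ z : ℝ in 𝓝[>] 0, z ^ (1 - α) / (1 - α) ≤ U.gain α l (U.threshold α l) := by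
    rcases lt_or_gt_of_ne hα1 with h | h
    · have h1 : 0 < 1 - α := sub_pos.2 h
      have hc : Tendsto (fun z : ℝ => z ^ (1 - α) / (1 - α)) (𝓝 0) (𝓝 0) := by
        have := ((Real.continuousAt_rpow_const 0 (1 - α) (Or.inr h1.le)).tendsto).div_const (1 - α)
        simpa [Real.zero_rpow h1.ne'] using this
      filter_upwards [nhdsWithin_le_nhds (hc.eventually (Iio_mem_nhds (U.gain_pos hα h hαγ hl)))]
        with z hz using le_of_lt hz
    · have h1 : 1 - α < 0 := sub_neg.2 h
      have := (tendsto_rpow_neg_nhdsGT_zero h1).eventually_ge_atTop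
        (U.gain α l (U.threshold α l) * (1 - α))
      filter_upwards [this] with z hz
      rwa [div_le_iff_of_neg h1]
  obtain ⟨m, hm, hsub⟩ := (mem_nhdsGT_iff_exists_Ioc_subset).1 hev
  refine ⟨m, hm, fun z hz hzm => ?_⟩
  have h1 : z ^ (1 - α) / (1 - α) ≤ _ := hsub ⟨hz, hzm⟩
  have := mul_pos hl hz
  linarith

/-- Near `∞` the Lagrangian is below any level. -/
theorem exists_lagrangian_nonpos_at_top {α l : ℝ} (hα : 0 < α) (hα1 : α ≠ 1) (hl : 0 < l)
    (g : ℝ) : ∃ M, 0 < M ∧ ∀ z, M ≤ z → z ^ (1 - α) / (1 - α) - l * z - g ≤ 0 := by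
  -- The tangent line at `x` has slope `l / 2`.
  set x : ℝ := (l / 2) ^ (-(1 / α)) with hx
  have hxp : 0 < x := by positivity
  have hs : x ^ (-α) = l / 2 := by
    rw [hx, ← Real.rpow_mul (by positivity), show -(1 / α) * -α = 1 by field_simp, Real.rpow_one]
  refine ⟨max 1 (2 / l * (x ^ (1 - α) / (1 - α) - g)), lt_max_of_lt_left one_pos,
    fun z hz => ?_⟩
  have hz0 : 0 < z := one_pos.trans_le ((le_max_left _ _).trans hz)
  have h1 := rpow_div_le_tangent hα hα1 hxp hz0
  rw [hs] at h1
  have h2 := mul_le_mul_of_nonneg_left ((le_max_right _ _).trans hz) (half_pos hl).le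
  rw [← mul_assoc, show l / 2 * (2 / l) = 1 by field_simp, one_mul] at h2
  have := mul_pos hl hxp
  linarith

/-- The average Lagrangian of an arbitrary policy exceeds the gain of the threshold by at most
`C / τ`.
The potential may be unbounded near `0`; since the Lagrangian is below its gain there, the potential
may be cut off at a constant without losing the balance inequality. -/
theorem User.exists_integral_le (U : User) {α l : ℝ} (hα : 0 < α) (hα1 : α ≠ 1)
    (hαγ : 2 - α - U.γ ≠ 0) (hl : 0 < l) (T : Policy) :
    ∃ C, ∀ τ : ℝ, 0 ≤ τ → ∫ t in (0 : ℝ)..τ, U.path T t ^ (1 - α) / (1 - α)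
      ≤ l * (∫ t in (0 : ℝ)..τ, U.path T t) + U.gain α l (U.threshold α l) * τ + C := by
  set g := U.gain α l (U.threshold α l) with hg
  set H := U.lagPot α l (U.threshold α l) with hH
  set F : ℝ → ℝ := fun z => z ^ (1 - α) / (1 - α) - l * z - g with hFdef
  have hd : ∀ z, 0 < z → HasDerivAt H (F z * z ^ (-U.γ) / U.a) z :=
    fun z hz => U.hasDerivAt_lagPot α l _ hz
  have hcr : ContinuousOn (fun z : ℝ => z ^ (1 - α) / (1 - α)) (Ioi 0) :=
    (rpow_continuousOn_Ioi _).div_const _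
  have hF : ContinuousOn F (Ioi 0) := by
    refine (hcr.sub ?_).sub ?_ <;> fun_prop
  obtain ⟨m, hm, hFm⟩ := U.exists_lagrangian_nonpos_near_zero hα hα1 hαγ hl
  obtain ⟨M, hM, hFM⟩ := exists_lagrangian_nonpos_at_top hα hα1 hl g
  have hanti : AntitoneOn H (Ici M) := by
    refine antitoneOn_of_deriv_nonpos (convex_Ici M)
      (fun z hz => (hd z (hM.trans_le hz)).continuousAt.continuousWithinAt)
      (fun z hz => ?_) fun z hz => ?_ <;> rw [interior_Ici] at hz
    · exact (hd z (hM.trans hz)).differentiableAt.differentiableWithinAt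
    · rw [(hd z (hM.trans hz)).deriv]
      exact div_nonpos_of_nonpos_of_nonneg (mul_nonpos_of_nonpos_of_nonneg (hFM z (le_of_lt hz))
        (Real.rpow_nonneg (hM.trans hz).le _)) U.a_pos.le
  obtain ⟨K, hK⟩ : ∃ K, ∀ z, m ≤ z → H z ≤ K := by
    have hc : ContinuousOn H (Icc m M) :=
      fun z hz => (hd z (hm.trans_le hz.1)).continuousAt.continuousWithinAt
    obtain ⟨K, hK⟩ := isCompact_Icc.bddAbove_image hc
    refine ⟨max K (H M), fun z hz => ?_⟩
    rcases le_total z M with h | h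
    · exact le_max_of_le_left (hK ⟨z, ⟨hz, h⟩, rfl⟩)
    · exact le_max_of_le_right (hanti self_mem_Ici h h)
  have hflow : ∀ y t, 0 < y → 0 ≤ t → ∫ s in (0 : ℝ)..t, F (U.flow y s)
      ≤ min (H (U.flow y t)) K - min (H y) K := by
    intro y t hy ht
    have hi := U.integral_comp_flow hF hd hy ht
    rcases le_or_gt (H (U.flow y t)) K with h | h
    · rw [hi, min_eq_left h]
      linarith [min_le_left (H y) K]
    · have hlt : U.flow y t < m := by
        by_contra! h'
        exact absurd (hK _ h') (not_le.2 h)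
      have h1 : ∫ s in (0 : ℝ)..t, F (U.flow y s) ≤ 0 := by
        rw [← neg_nonneg, ← intervalIntegral.integral_neg]
        refine intervalIntegral.integral_nonneg ht fun s hs =>
          neg_nonneg.2 (hFm _ (U.flow_pos hy hs.1) ?_)
        refine le_trans ?_ hlt.le
        rw [U.le_flow_iff (U.flow_pos hy hs.1) hy ht, U.pot_zero_flow hy hs.1]
        linarith [hs.2]
      have h2 : K ≤ H y := by linarith
      rw [min_eq_right h.le, min_eq_right h2, sub_self]
      exact h1
  refine ⟨K - min (H U.x₀) K, fun τ hτ => ?_⟩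
  have hb := U.integral_path_le (H := fun z => min (H z) K) hF hflow T hτ
  have hs : ∑ i ∈ Finset.range (T.count τ),
      (min (H (U.pre T i)) K - min (H (U.b * U.pre T i)) K) ≤ 0 := by
    refine Finset.sum_nonpos fun i hi => sub_nonpos.2 (min_le_min_right K ?_)
    rw [Finset.mem_range] at hi
    refine U.lagPot_le_mul hα hα1 hαγ hl (U.flow_pos (U.post_pos T fun j hj =>
      T.time_ne_top_of_lt_count (hj.trans hi)) (sub_nonneg.2 (T.start_mono ?_)))
    exact T.time_ne_top_of_lt_count hi
  have hi1 := U.intervalIntegrable_path hcr T hτ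
  have hi2 := U.intervalIntegrable_path (F := fun z => z) (by fun_prop) T hτ
  have e : ∫ t in (0 : ℝ)..τ, F (U.path T t)
      = (∫ t in (0 : ℝ)..τ, U.path T t ^ (1 - α) / (1 - α))
        - l * (∫ t in (0 : ℝ)..τ, U.path T t) - g * τ := by
    simp only [hFdef]
    rw [intervalIntegral.integral_sub (hi1.sub (hi2.const_mul l)) (by simp),
      intervalIntegral.integral_sub hi1 (hi2.const_mul l), intervalIntegral.integral_const_mul]
    simp [mul_comm]
  rw [e] at hb
  linarith [min_le_right (H (U.path T τ)) K]

/-! ### Threshold policies -/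

/-- The time that the uncontrolled flow from `y` needs to reach the level `X`; it is `0` if
`X ≤ y`. -/
noncomputable def User.hit (U : User) (X y : ℝ) : ℝ := max 0 (U.pot 0 X - U.pot 0 y)

theorem User.hit_nonneg (U : User) (X y : ℝ) : 0 ≤ U.hit X y := le_max_left _ _

theorem User.isLeast_hit (U : User) {X y : ℝ} (hX : 0 < X) (hy : 0 < y) (s : ℝ) :
    IsLeast {t | s ≤ t ∧ X ≤ U.flow y (t - s)} (s + U.hit X y) := by
  refine ⟨⟨le_add_of_nonneg_right (U.hit_nonneg X y), ?_⟩, fun t ht => ?_⟩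
  · rw [add_sub_cancel_left, U.le_flow_iff hX hy (U.hit_nonneg X y)]
    exact le_max_right _ _
  · have h := (U.le_flow_iff hX hy (sub_nonneg.2 ht.1)).1 ht.2
    rw [← le_sub_iff_add_le']
    exact max_le (sub_nonneg.2 ht.1) h

theorem User.pot_zero_max (U : User) {X y : ℝ} (hX : 0 < X) (hy : 0 < y) :
    U.pot 0 (max X y) = U.pot 0 y + U.hit X y := by
  rw [(U.pot_strictMonoOn 0).monotoneOn.map_max hX hy, User.hit]
  rcases le_total (U.pot 0 X) (U.pot 0 y) with h | h
  · rw [max_eq_right h, max_eq_left (by linarith), add_zero]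
  · rw [max_eq_left h, max_eq_right (by linarith), add_sub_cancel]

theorem User.flow_hit (U : User) {X y : ℝ} (hX : 0 < X) (hy : 0 < y) :
    U.flow y (U.hit X y) = max X y :=
  (U.pot_strictMonoOn 0).injOn (U.flow_pos hy (U.hit_nonneg X y)) (lt_max_of_lt_left hX)
    (by rw [U.pot_zero_flow hy (U.hit_nonneg X y), U.pot_zero_max hX hy])

/-- The post-impulse states under the threshold `X`. -/
noncomputable def User.orbit (U : User) (X : ℝ) : ℕ → ℝ
  | 0 => U.x₀
  | n + 1 => U.b * max X (U.orbit X n)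

/-- The impulse times under the threshold `X`, preceded by the initial time. -/
noncomputable def User.orbitTime (U : User) (X : ℝ) : ℕ → ℝ
  | 0 => 0
  | n + 1 => U.orbitTime X n + U.hit X (U.orbit X n)

theorem User.orbit_ge (U : User) (X : ℝ) (n : ℕ) :
    min U.x₀ (U.b * X) ≤ U.orbit X n := by
  cases n with
  | zero => exact min_le_left _ _
  | succ n =>
    exact (min_le_right _ _).trans
      (mul_le_mul_of_nonneg_left (le_max_left _ _) U.b_mem.1.le)

theorem User.orbit_bound_pos (U : User) {X : ℝ} (hX : 0 < X) : 0 < min U.x₀ (U.b * X) :=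
  lt_min U.x₀_pos (mul_pos U.b_mem.1 hX)

theorem User.orbit_pos (U : User) {X : ℝ} (hX : 0 < X) (n : ℕ) : 0 < U.orbit X n :=
  (U.orbit_bound_pos hX).trans_le (U.orbit_ge X n)

theorem User.orbit_le (U : User) {X : ℝ} (hX : 0 < X) (n : ℕ) :
    U.orbit X n ≤ max X (U.b ^ n * U.x₀) := by
  induction n with
  | zero => simp [User.orbit]
  | succ n ih =>
    have h1 : max X (U.orbit X n) ≤ max X (U.b ^ n * U.x₀) := max_le (le_max_left _ _) ih
    refine (mul_le_mul_of_nonneg_left h1 U.b_mem.1.le).trans ?_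
    rw [mul_max_of_nonneg _ _ U.b_mem.1.le, pow_succ', mul_assoc]
    exact max_le_max_right _ (mul_le_of_le_one_left hX.le U.b_mem.2.le)

theorem User.orbitTime_mono (U : User) (X : ℝ) : Monotone (U.orbitTime X) :=
  monotone_nat_of_le_succ fun _ => le_add_of_nonneg_right (U.hit_nonneg _ _)

/-- Every impulse sets the clock `pot 0` back by at least a fixed amount, so that the impulse times
do not accumulate. -/
theorem User.orbitTime_ge (U : User) {X : ℝ} (hX : 0 < X) (n : ℕ) :
    U.pot 0 (U.orbit X n) - U.pot 0 U.x₀ + n * (X ^ (1 - U.γ) / U.a * powGap U.b (1 - U.γ))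
      ≤ U.orbitTime X n := by
  induction n with
  | zero => simp [User.orbit, User.orbitTime]
  | succ n ih =>
    have hm : 0 < max X (U.orbit X n) := lt_max_of_lt_left hX
    have h1 := U.pot_sub_pot_mul 0 hm
    rw [Real.rpow_zero, one_mul, zero_add, U.pot_zero_max hX (U.orbit_pos hX n)] at h1
    have h2 : X ^ (1 - U.γ) / U.a * powGap U.b (1 - U.γ)
        ≤ max X (U.orbit X n) ^ (1 - U.γ) / U.a * powGap U.b (1 - U.γ) := by
      refine mul_le_mul_of_nonneg_right (div_le_div_of_nonneg_right ?_ U.a_pos.le)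
        (U.powGap_pos _).le
      exact Real.rpow_le_rpow hX.le (le_max_left _ _) (sub_nonneg.2 U.γ_mem.2)
    rw [User.orbit, User.orbitTime]
    push_cast
    linarith

theorem User.tendsto_orbitTime (U : User) {X : ℝ} (hX : 0 < X) :
    Tendsto (U.orbitTime X) atTop atTop := by
  have hε : 0 < X ^ (1 - U.γ) / U.a * powGap U.b (1 - U.γ) :=
    mul_pos (div_pos (Real.rpow_pos_of_pos hX _) U.a_pos) (U.powGap_pos _)
  refine tendsto_atTop_mono (fun n => ?_) (tendsto_atTop_add_const_left _
    (U.pot 0 (min U.x₀ (U.b * X)) - U.pot 0 U.x₀)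
    (tendsto_natCast_atTop_atTop.atTop_mul_const hε))
  have := (U.pot_strictMonoOn 0).monotoneOn (U.orbit_bound_pos hX) (U.orbit_pos hX n)
    (U.orbit_ge X n)
  linarith [U.orbitTime_ge hX n]

/-- The policy induced by the threshold `X`. -/
noncomputable def User.thresholdPolicy (U : User) {X : ℝ} (hX : 0 < X) : Policy where
  time n := ENNReal.ofReal (U.orbitTime X (n + 1))
  mono _ _ h := ENNReal.ofReal_le_ofReal (U.orbitTime_mono X (Nat.succ_le_succ h))
  tendsto_top := ENNReal.tendsto_ofReal_atTop.comp
    ((U.tendsto_orbitTime hX).comp (tendsto_add_atTop_nat 1))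

theorem User.orbitTime_nonneg (U : User) (X : ℝ) (n : ℕ) : 0 ≤ U.orbitTime X n :=
  U.orbitTime_mono X (Nat.zero_le n)

theorem User.post_eq_orbit (U : User) {X : ℝ} (hX : 0 < X) {T : Policy} {n : ℕ}
    (h : ∀ i ≤ n, T.start i = U.orbitTime X i) : U.post T n = U.orbit X n := by
  induction n with
  | zero => rfl
  | succ n ih =>
    rw [User.post, User.orbit, h _ le_rfl, h n (Nat.le_succ n), ih fun i hi => h i (by omega),
      User.orbitTime, add_sub_cancel_left, U.flow_hit hX (U.orbit_pos hX n)]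

/-- The impulse times of a threshold policy are determined one after the other, since each
post-impulse state depends on the earlier times only. -/
theorem User.isThreshold_iff (U : User) {X : ℝ} (hX : 0 < X) (T : Policy) :
    U.IsThreshold X T ↔ ∀ n, T.time n = ENNReal.ofReal (U.orbitTime X (n + 1)) := by
  have hl : ∀ n, (∀ i ≤ n, T.start i = U.orbitTime X i) →
      IsLeast {t | T.start n ≤ t ∧ X ≤ U.stateAfter T n t} (U.orbitTime X (n + 1)) := by
    intro n h
    have := U.isLeast_hit hX (U.orbit_pos hX n) (U.orbitTime X n)
    rw [← h n le_rfl, ← U.post_eq_orbit hX h] at this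
    rwa [User.orbitTime, ← h n le_rfl, ← U.post_eq_orbit hX h]
  have hs : ∀ n, T.time n = ENNReal.ofReal (U.orbitTime X (n + 1)) →
      T.start (n + 1) = U.orbitTime X (n + 1) := fun n h => by
    rw [Policy.start, h, ENNReal.toReal_ofReal (U.orbitTime_nonneg X _)]
  constructor
  · intro h
    have hst : ∀ n, ∀ i ≤ n, T.start i = U.orbitTime X i := by
      intro n
      induction n with
      | zero => intro i hi; rw [Nat.le_zero.1 hi]; rfl
      | succ n ih =>
        intro i hi
        rcases Nat.le_succ_iff.1 hi with hi | rfl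
        · exact ih i hi
        · obtain ⟨t, ht, e⟩ := h n
          exact hs n (by rw [e, ht.unique (hl n ih)])
    intro n
    obtain ⟨t, ht, e⟩ := h n
    rw [e, ht.unique (hl n (hst n))]
  · intro h n
    refine ⟨_, hl n fun i _ => ?_, h n⟩
    cases i with
    | zero => rfl
    | succ i => exact hs i (h i)

theorem User.existsUnique_isThreshold (U : User) {X : ℝ} (hX : 0 < X) :
    ∃! T : Policy, U.IsThreshold X T := by
  refine ⟨U.thresholdPolicy hX, (U.isThreshold_iff hX _).2 fun _ => rfl, fun T hT => ?_⟩
  ext1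
  funext n
  exact (U.isThreshold_iff hX T).1 hT n

theorem User.IsThreshold.start_eq {U : User} {X : ℝ} {T : Policy} (h : U.IsThreshold X T)
    (hX : 0 < X) (n : ℕ) : T.start n = U.orbitTime X n := by
  cases n with
  | zero => rfl
  | succ n => rw [Policy.start, (U.isThreshold_iff hX T).1 h n,
      ENNReal.toReal_ofReal (U.orbitTime_nonneg X _)]

theorem User.IsThreshold.post_eq {U : User} {X : ℝ} {T : Policy} (h : U.IsThreshold X T)
    (hX : 0 < X) (n : ℕ) : U.post T n = U.orbit X n :=
  U.post_eq_orbit hX fun i _ => h.start_eq hX i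

theorem User.IsThreshold.pre_eq {U : User} {X : ℝ} {T : Policy} (h : U.IsThreshold X T)
    (hX : 0 < X) (n : ℕ) : U.pre T n = max X (U.orbit X n) := by
  rw [User.pre, User.stateAfter, h.post_eq hX, h.start_eq hX, h.start_eq hX, User.orbitTime,
    add_sub_cancel_left, U.flow_hit hX (U.orbit_pos hX n)]

theorem User.IsThreshold.path_mem {U : User} {X : ℝ} {T : Policy} (h : U.IsThreshold X T)
    (hX : 0 < X) {t : ℝ} (ht : 0 ≤ t) :
    U.path T t ∈ Icc (min U.x₀ (U.b * X)) (max X U.x₀) := by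
  have h1 := T.start_count_le ht
  have h2 : ENNReal.ofReal t ≤ T.time (T.count t) := (T.time_ge_iff t _).2 le_rfl
  rw [(U.isThreshold_iff hX T).1 h, ENNReal.ofReal_le_ofReal_iff (U.orbitTime_nonneg X _)] at h2
  rw [h.start_eq hX] at h1
  rw [User.path, User.stateAfter, h.post_eq hX, h.start_eq hX]
  set n := T.count t
  have hp := U.orbit_pos hX n
  refine ⟨(U.orbit_ge X n).trans (U.le_flow hp (sub_nonneg.2 h1)), ?_⟩
  have h3 : U.flow (U.orbit X n) (t - U.orbitTime X n) ≤ max X (U.orbit X n) := by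
    rw [← U.flow_hit hX hp, U.le_flow_iff (U.flow_pos hp (sub_nonneg.2 h1)) hp
      (U.hit_nonneg _ _), U.pot_zero_flow hp (sub_nonneg.2 h1)]
    rw [User.orbitTime] at h2
    linarith
  refine h3.trans (max_le (le_max_left _ _) ((U.orbit_le hX n).trans (max_le_max_left _ ?_)))
  exact mul_le_of_le_one_left U.x₀_pos.le (pow_le_one₀ U.b_mem.1.le U.b_mem.2.le)

/-- Under a threshold policy the trajectory stays in a compact set and, after finitely many
impulses, every impulse closes a cycle that contributes exactly the average. -/
theorem User.IsThreshold.exists_abs_integral_sub_le {U : User} {X : ℝ} {T : Policy}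
    (h : U.IsThreshold X T) (hX : 0 < X) (q : ℝ) :
    ∃ C, ∀ τ : ℝ, 0 ≤ τ → |(∫ t in (0 : ℝ)..τ, U.path T t ^ q) - U.avg X q * τ| ≤ C := by
  set H : ℝ → ℝ := fun z => U.pot q z - U.avg X q * U.pot 0 z with hHdef
  have hd : ∀ z, 0 < z → HasDerivAt H ((z ^ q - U.avg X q) * z ^ (-U.γ) / U.a) z := by
    intro z hz
    refine ((U.hasDerivAt_pot q hz).sub
      ((U.hasDerivAt_pot 0 hz).const_mul (U.avg X q))).congr_deriv ?_
    rw [Real.rpow_zero]; ring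
  have hcycle : H X - H (U.b * X) = 0 := by
    have h1 := U.pot_sub_pot_mul q hX
    have h2 := U.pot_sub_pot_mul 0 hX
    rw [Real.rpow_zero, one_mul, zero_add] at h2
    have e : H X - H (U.b * X) = (U.pot q X - U.pot q (U.b * X))
        - U.avg X q * (U.pot 0 X - U.pot 0 (U.b * X)) := by simp only [hHdef]; ring
    have h3 := (U.powGap_pos (1 - U.γ)).ne'
    rw [e, h1, h2, User.avg]
    field_simp
    ring
  have hc : ContinuousOn H (Icc (min U.x₀ (U.b * X)) (max X U.x₀)) := fun z hz =>
    (hd z ((U.orbit_bound_pos hX).trans_le hz.1)).continuousAt.continuousWithinAt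
  obtain ⟨B, hB⟩ := isCompact_Icc.exists_bound_of_continuousOn hc
  obtain ⟨n₀, hn₀⟩ : ∃ n₀ : ℕ, ∀ n, n₀ ≤ n → U.pre T n = X := by
    have ht : Tendsto (fun n : ℕ => U.b ^ n * U.x₀) atTop (𝓝 0) := by
      simpa using (tendsto_pow_atTop_nhds_zero_of_lt_one U.b_mem.1.le U.b_mem.2).mul_const U.x₀
    obtain ⟨n₀, hn₀⟩ := eventually_atTop.1 (ht.eventually (Iio_mem_nhds hX))
    refine ⟨n₀, fun n hn => ?_⟩
    rw [h.pre_eq hX]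
    exact max_eq_left ((U.orbit_le hX n).trans (max_le le_rfl (le_of_lt (hn₀ n hn))))
  set w : ℕ → ℝ := fun i => H (U.pre T i) - H (U.b * U.pre T i) with hw
  have hsum : ∀ n, |∑ i ∈ Finset.range n, w i| ≤ ∑ i ∈ Finset.range n₀, |w i| := by
    intro n
    refine (Finset.abs_sum_le_sum_abs _ _).trans ?_
    have e : ∑ i ∈ Finset.range n₀, |w i| = ∑ i ∈ Finset.range (max n n₀), |w i| := by
      refine Finset.sum_subset (Finset.range_mono (le_max_right _ _)) fun i _ hi => ?_
      rw [Finset.mem_range, not_lt] at hi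
      simp only [hw]
      rw [hn₀ i hi, hcycle, abs_zero]
    rw [e]
    exact Finset.sum_le_sum_of_subset_of_nonneg (Finset.range_mono (le_max_left _ _))
      fun i _ _ => abs_nonneg _
  refine ⟨B + |H U.x₀| + ∑ i ∈ Finset.range n₀, |w i|, fun τ hτ => ?_⟩
  have hF : ContinuousOn (fun z : ℝ => z ^ q - U.avg X q) (Ioi 0) :=
    (rpow_continuousOn_Ioi q).sub continuousOn_const
  have hi := U.integral_path_eq hF hd T hτ
  rw [intervalIntegral.integral_sub (U.intervalIntegrable_path (rpow_continuousOn_Ioi q) T hτ)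
    (by simp)] at hi
  have e : (∫ t in (0 : ℝ)..τ, U.path T t ^ q) - U.avg X q * τ
      = H (U.path T τ) - H U.x₀ + ∑ i ∈ Finset.range (T.count τ), w i := by
    rw [← hi]; simp [mul_comm]
  rw [e]
  refine (abs_add_le _ _).trans (add_le_add ((abs_sub _ _).trans (add_le_add_left ?_ _)) (hsum _))
  exact hB _ (h.path_mem hX hτ)

theorem User.IsThreshold.tendsto_average {U : User} {X : ℝ} {T : Policy}
    (h : U.IsThreshold X T) (hX : 0 < X) (q : ℝ) :
    Tendsto (fun τ : ℝ => 1 / τ * ∫ t in (0 : ℝ)..τ, U.path T t ^ q) atTop (𝓝 (U.avg X q)) := by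
  obtain ⟨C, hC⟩ := h.exists_abs_integral_sub_le hX q
  rw [tendsto_iff_norm_sub_tendsto_zero]
  refine squeeze_zero' (Eventually.of_forall fun _ => norm_nonneg _) ?_
    (tendsto_const_nhds.div_atTop tendsto_id : Tendsto (fun τ : ℝ => C / τ) atTop (𝓝 0))
  filter_upwards [eventually_gt_atTop 0] with τ hτ
  have e : 1 / τ * (∫ t in (0 : ℝ)..τ, U.path T t ^ q) - U.avg X q
      = ((∫ t in (0 : ℝ)..τ, U.path T t ^ q) - U.avg X q * τ) / τ := by
    field_simp
  rw [e, Real.norm_eq_abs, abs_div, abs_of_pos hτ]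
  exact div_le_div_of_nonneg_right (hC τ hτ.le) hτ.le

theorem Policy.toMixed_expect (T : Policy) (F : Policy → ℝ) : T.toMixed.expect F = F T := by
  simp [Policy.toMixed, MixedPolicy.expect]

theorem User.IsThreshold.G_eq {U : User} {X : ℝ} {T : Policy}
    (h : U.IsThreshold X T) (hX : 0 < X) : U.G T.toMixed = (U.avg X 1 : EReal) := by
  have := h.tendsto_average hX 1
  simp only [Real.rpow_one] at this
  simp only [User.G, Policy.toMixed_expect]
  exact (EReal.tendsto_coe.2 this).limsup_eq

theorem User.IsThreshold.J_eq {U : User} {X : ℝ} {T : Policy}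
    (h : U.IsThreshold X T) (hX : 0 < X) (α : ℝ) :
    U.J α T.toMixed = (U.avg X (1 - α) / (1 - α) : ℝ) := by
  have := (h.tendsto_average hX (1 - α)).div_const (1 - α)
  simp only [User.J, Policy.toMixed_expect, intervalIntegral.integral_div, ← mul_div_assoc]
  exact (EReal.tendsto_coe.2 this).liminf_eq

/-! ### Lagrangian duality -/

theorem MixedPolicy.exists_expect_le {U : User} {α l : ℝ} (hα : 0 < α) (hα1 : α ≠ 1)
    (hαγ : 2 - α - U.γ ≠ 0) (hl : 0 < l) (u : MixedPolicy) :
    ∃ C, ∀ τ : ℝ, 0 ≤ τ →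
      u.expect (fun T => ∫ t in (0 : ℝ)..τ, U.path T t ^ (1 - α) / (1 - α))
        ≤ l * u.expect (fun T => ∫ t in (0 : ℝ)..τ, U.path T t)
          + U.gain α l (U.threshold α l) * τ + C := by
  obtain ⟨C₁, h₁⟩ := U.exists_integral_le hα hα1 hαγ hl u.T
  obtain ⟨C₂, h₂⟩ := U.exists_integral_le hα hα1 hαγ hl u.S
  refine ⟨u.β * C₁ + (1 - u.β) * C₂, fun τ hτ => ?_⟩
  have h3 := mul_le_mul_of_nonneg_left (h₁ τ hτ) u.β_mem.1
  have h4 := mul_le_mul_of_nonneg_left (h₂ τ hτ) (sub_nonneg.2 u.β_mem.2)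
  unfold MixedPolicy.expect
  linarith

theorem User.G_nonneg (U : User) (u : MixedPolicy) : 0 ≤ U.G u := by
  refine le_limsup_of_frequently_le (Eventually.frequently ?_) (by isBoundedDefault)
  filter_upwards [eventually_gt_atTop 0] with τ hτ
  have h : ∀ T, 0 ≤ ∫ t in (0 : ℝ)..τ, U.path T t := fun T =>
    intervalIntegral.integral_nonneg hτ.le fun t ht => (U.path_pos T ht.1).le
  exact EReal.coe_nonneg.2 (mul_nonneg (by positivity)
    (add_nonneg (mul_nonneg u.β_mem.1 (h _)) (mul_nonneg (sub_nonneg.2 u.β_mem.2) (h _))))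

/-- Weak duality for one user. -/
theorem User.J_le (U : User) {α l : ℝ} (hα : 0 < α) (hα1 : α ≠ 1)
    (hαγ : 2 - α - U.γ ≠ 0) (hl : 0 < l) {u : MixedPolicy} {r : ℝ} (hr : U.G u = (r : EReal)) :
    U.J α u ≤ ((l * r + U.gain α l (U.threshold α l) : ℝ) : EReal) := by
  obtain ⟨C, hC⟩ := u.exists_expect_le hα hα1 hαγ hl
  refine EReal.le_of_forall_lt_iff_le.1 fun z hz => ?_
  rw [EReal.coe_lt_coe_iff] at hz
  set g := U.gain α l (U.threshold α l)
  -- Half of the slack `z - (l * r + g)` absorbs the upper limit, the other half absorbs `C / τ`.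
  set ε := (z - (l * r + g)) / 2 with hε
  have hεp : 0 < ε := by linarith
  have h1 : ∀ᶠ τ : ℝ in atTop,
      ((1 / τ * u.expect (fun T => ∫ t in (0 : ℝ)..τ, U.path T t) : ℝ) : EReal)
        < ((r + ε / l : ℝ) : EReal) := by
    refine eventually_lt_of_limsup_lt ?_ (by isBoundedDefault)
    change U.G u < _
    rw [hr, EReal.coe_lt_coe_iff]
    exact lt_add_of_pos_right _ (div_pos hεp hl)
  have h2 : ∀ᶠ τ : ℝ in atTop, C / τ < ε :=
    (tendsto_const_nhds.div_atTop tendsto_id : Tendsto (fun τ : ℝ => C / τ) atTop (𝓝 0)).eventually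
      (Iio_mem_nhds hεp)
  refine liminf_le_of_frequently_le' (Eventually.frequently ?_)
  filter_upwards [h1, h2, eventually_gt_atTop 0] with τ h1 h2 hτ
  rw [EReal.coe_lt_coe_iff] at h1
  rw [EReal.coe_le_coe_iff]
  have h3 := mul_le_mul_of_nonneg_left (hC τ hτ.le) (one_div_pos.2 hτ).le
  have h4 := mul_lt_mul_of_pos_left h1 hl
  have e1 : l * (r + ε / l) = l * r + ε := by field_simp
  rw [e1] at h4
  refine h3.trans ?_
  have e2 : 1 / τ * (l * u.expect (fun T => ∫ t in (0 : ℝ)..τ, U.path T t) + g * τ + C)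
      = l * (1 / τ * u.expect (fun T => ∫ t in (0 : ℝ)..τ, U.path T t)) + g + C / τ := by
    field_simp
  rw [e2]
  linarith

theorem coe_finset_sum {ι : Type*} (s : Finset ι) (f : ι → ℝ) :
    ((∑ i ∈ s, f i : ℝ) : EReal) = ∑ i ∈ s, (f i : EReal) :=
  map_sum (⟨⟨Real.toEReal, EReal.coe_zero⟩, EReal.coe_add⟩ : ℝ →+ EReal) f s

variable {N : ℕ}

/-- Strong duality: if the threshold policies of a multiplier exhaust the budget, they are
optimal. -/
theorem isOptimal_of_sum_avg_eq (U : Fin N → User) {α c l : ℝ} (hα : 0 < α) (hα1 : α ≠ 1)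
    (hαγ : ∀ k, 2 - α - (U k).γ ≠ 0) (hl : 0 < l)
    (hsum : ∑ k, (U k).avg ((U k).threshold α l) 1 = c) {T : Fin N → Policy}
    (hT : ∀ k, (U k).IsThreshold ((U k).threshold α l) (T k)) :
    IsOptimal U α c fun k => (T k).toMixed := by
  have hX : ∀ k, 0 < (U k).threshold α l := fun k => (U k).threshold_pos (hαγ k) hl
  refine ⟨?_, fun v hv => ?_⟩
  · simp only [totalG, fun k => (hT k).G_eq (hX k), ← coe_finset_sum, hsum, le_refl]
  · have hfin : ∀ k, ∃ r : ℝ, (U k).G (v k) = (r : EReal) := by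
      intro k
      have h1 : (U k).G (v k) ≤ (c : EReal) :=
        (Finset.single_le_sum (f := fun k => (U k).G (v k)) (fun k _ => (U k).G_nonneg (v k))
          (Finset.mem_univ k)).trans hv
      refine ⟨((U k).G (v k)).toReal, (EReal.coe_toReal ?_ ?_).symm⟩
      · exact (h1.trans_lt (EReal.coe_lt_top c)).ne
      · exact ((EReal.bot_lt_zero).trans_le ((U k).G_nonneg (v k))).ne'
    choose r hr using hfin
    have hrc : ∑ k, r k ≤ c := by
      simpa only [totalG, hr, ← coe_finset_sum, EReal.coe_le_coe_iff] using hv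
    calc totalJ U α v ≤ ∑ k, ((l * r k + (U k).gain α l ((U k).threshold α l) : ℝ) : EReal) :=
          Finset.sum_le_sum fun k _ => (U k).J_le hα hα1 (hαγ k) hl (hr k)
      _ ≤ ∑ k, (((U k).avg ((U k).threshold α l) (1 - α) / (1 - α) : ℝ) : EReal) := by
          rw [← coe_finset_sum, ← coe_finset_sum, EReal.coe_le_coe_iff]
          simp only [User.gain, Finset.sum_add_distrib, Finset.sum_sub_distrib, ← Finset.mul_sum,
            hsum]
          linarith [mul_le_mul_of_nonneg_left hrc hl.le]
      _ = totalJ U α fun k => (T k).toMixed := by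
          simp only [totalJ, fun k => (hT k).J_eq (hX k) α]

/-! ### The multiplier -/

/-- The average allocation of a user under the threshold of the multiplier `l` is
`coef * l ^ (-1 / α)`; see `User.avg_threshold`. -/
noncomputable def User.coef (U : User) (α : ℝ) : ℝ :=
  powGap U.b (1 + 1 - U.γ) / powGap U.b (1 - U.γ) *
    (powGap U.b (1 - α + 1 - U.γ) / powGap U.b (1 + 1 - U.γ)) ^ (1 / α)

theorem User.coef_pos (U : User) (α : ℝ) : 0 < U.coef α := by
  have h1 := U.powGap_pos (1 + 1 - U.γ)
  have h2 := U.powGap_pos (1 - α + 1 - U.γ)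
  have h3 := U.powGap_pos (1 - U.γ)
  unfold User.coef
  positivity

theorem User.avg_threshold (U : User) {α l : ℝ} (hαγ : 2 - α - U.γ ≠ 0) (hl : 0 < l) :
    U.avg (U.threshold α l) 1 = U.coef α * l ^ (-(1 / α)) := by
  have h1 := U.powGap_pos (1 + 1 - U.γ)
  have h2 := U.powGap_pos (1 - α + 1 - U.γ)
  rw [User.avg, Real.rpow_one, U.threshold_eq hαγ, User.coef, ← div_div,
    Real.div_rpow (by positivity) hl.le, Real.rpow_neg hl.le]
  ring

theorem User.coef_of_ne (U : User) {α : ℝ} (hαγ : 2 - α - U.γ ≠ 0) (hγ : U.γ ≠ 1) :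
    U.coef α = (1 - U.γ) / (2 - U.γ) * ((1 - U.b ^ (2 - U.γ)) / (1 - U.b ^ (1 - U.γ))) *
      ((2 - U.γ) / (1 - U.b ^ (2 - U.γ))) ^ (1 / α) *
      ((1 - U.b ^ (2 - α - U.γ)) / (2 - α - U.γ)) ^ (1 / α) := by
  have h2 := U.powGap_pos (2 - U.γ)
  have h1 := U.powGap_pos (2 - α - U.γ)
  have e1 : 1 - U.γ ≠ 0 := sub_ne_zero.2 hγ.symm
  have e2 : 2 - U.γ ≠ 0 := by linarith [U.γ_mem.2]
  rw [User.coef, show 1 - α + 1 - U.γ = 2 - α - U.γ by ring,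
    show (1 : ℝ) + 1 - U.γ = 2 - U.γ by ring, div_eq_mul_inv (powGap U.b (2 - α - U.γ)),
    Real.mul_rpow h1.le (inv_nonneg.2 h2.le), powGap_of_ne _ e1, powGap_of_ne _ e2,
    powGap_of_ne _ hαγ, inv_div]
  rw [div_div_div_eq, div_mul_div_comm]
  ring

theorem User.coef_of_eq (U : User) {α : ℝ} (hα : 0 < α) (hα1 : α ≠ 1) (hγ : U.γ = 1) :
    U.coef α = ((1 - U.b ^ (1 - α)) / (1 - α)) ^ (1 / α) *
      ((1 - U.b) ^ ((α - 1) / α) / (-Real.log U.b)) := by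
  have hb : 0 < 1 - U.b := sub_pos.2 U.b_mem.2
  have h1 := U.powGap_pos (1 - α)
  rw [User.coef, hγ, show 1 - α + 1 - 1 = 1 - α by ring, add_sub_cancel_right, sub_self,
    powGap_zero, powGap_of_ne _ one_ne_zero, Real.rpow_one, div_one, Real.div_rpow h1.le hb.le,
    powGap_of_ne _ (sub_ne_zero.2 hα1.symm), show (α - 1) / α = 1 - 1 / α by field_simp,
    Real.rpow_sub hb, Real.rpow_one]
  ring

theorem lamStar_eq (U : Fin N → User) {α c : ℝ} (hα : 0 < α) (hα1 : α ≠ 1)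
    (hαγ : ∀ k, 2 - α - (U k).γ ≠ 0) (hc : 0 < c) :
    lamStar U α c = ((∑ k, (U k).coef α) / c) ^ α := by
  classical
  rw [Real.div_rpow (Finset.sum_nonneg fun k _ => ((U k).coef_pos α).le) hc.le, lamStar,
    one_div_mul_eq_div, ← Finset.sum_filter_not_add_sum_filter Finset.univ
      (fun k => (U k).γ = 1) (fun k => (U k).coef α)]
  congr 3
  · refine Finset.sum_congr (by congr) fun k hk => ?_
    exact ((U k).coef_of_ne (hαγ k) (Finset.mem_filter.1 hk).2).symm
  · refine Finset.sum_congr (by congr) fun k hk => ?_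
    exact ((U k).coef_of_eq hα hα1 (Finset.mem_filter.1 hk).2).symm

theorem sum_coef_pos (U : Fin N → User) (α : ℝ) (k : Fin N) : 0 < ∑ k, (U k).coef α :=
  Finset.sum_pos (fun k _ => (U k).coef_pos α) ⟨k, Finset.mem_univ k⟩

theorem lamStar_pos (U : Fin N → User) {α c : ℝ} (hα : 0 < α) (hα1 : α ≠ 1)
    (hαγ : ∀ k, 2 - α - (U k).γ ≠ 0) (hc : 0 < c) (k : Fin N) : 0 < lamStar U α c := by
  rw [lamStar_eq U hα hα1 hαγ hc]
  exact Real.rpow_pos_of_pos (div_pos (sum_coef_pos U α k) hc) _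

theorem lamStar_rpow (U : Fin N → User) {α c : ℝ} (hα : 0 < α) (hα1 : α ≠ 1)
    (hαγ : ∀ k, 2 - α - (U k).γ ≠ 0) (hc : 0 < c) :
    lamStar U α c ^ (-(1 / α)) = c / ∑ k, (U k).coef α := by
  have h : 0 ≤ (∑ k, (U k).coef α) / c :=
    div_nonneg (Finset.sum_nonneg fun k _ => ((U k).coef_pos α).le) hc.le
  rw [lamStar_eq U hα hα1 hαγ hc, ← Real.rpow_mul h, show α * -(1 / α) = -1 by field_simp,
    Real.rpow_neg_one, inv_div]

theorem sum_avg_lamStar (U : Fin N → User) {α c : ℝ} (hα : 0 < α) (hα1 : α ≠ 1)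
    (hαγ : ∀ k, 2 - α - (U k).γ ≠ 0) (hc : 0 < c) (k : Fin N) :
    ∑ k, (U k).avg ((U k).threshold α (lamStar U α c)) 1 = c := by
  have hl := lamStar_pos U hα hα1 hαγ hc k
  have hS := (sum_coef_pos U α k).ne'
  simp only [fun k => (U k).avg_threshold (hαγ k) hl, lamStar_rpow U hα hα1 hαγ hc,
    ← Finset.sum_mul]
  field_simp

theorem User.exists_isThreshold_finite (U : User) {α l : ℝ} (hαγ : 2 - α - U.γ ≠ 0)
    (hl : 0 < l) : ∃ T : Policy, U.IsThreshold (U.threshold α l) T ∧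
      -U.J α T.toMixed = (-(U.avg (U.threshold α l) (1 - α) / (1 - α)) : ℝ) ∧
      U.G T.toMixed = (U.avg (U.threshold α l) 1 : EReal) := by
  have hX := U.threshold_pos hαγ hl
  obtain ⟨T, hT, -⟩ := U.existsUnique_isThreshold hX
  refine ⟨T, hT, ?_, hT.G_eq hX⟩
  rw [hT.J_eq hX, EReal.coe_neg]

theorem Ω_convex (U : Fin N → User) (α : ℝ) : Convex ℝ (Ω U α) :=
  convex_pi fun _ _ => convex_convexHull ℝ _

theorem negJtilde_convexOn {s : Set (Fin N → ℝ × ℝ)} (hs : Convex ℝ s) :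
    ConvexOn ℝ s negJtilde := by
  refine ⟨hs, fun x _ y _ a b _ _ _ => le_of_eq ?_⟩
  simp [negJtilde, Finset.sum_add_distrib, Finset.mul_sum]

theorem Gtilde_convexOn {s : Set (Fin N → ℝ × ℝ)} (hs : Convex ℝ s) :
    ConvexOn ℝ s Gtilde := by
  refine ⟨hs, fun x _ y _ a b _ _ _ => le_of_eq ?_⟩
  simp [Gtilde, Finset.sum_add_distrib, Finset.mul_sum]

/-- A large multiplier makes the total allocation small. -/
theorem exists_mem_Ω_Gtilde_lt (U : Fin N → User) {α c : ℝ} (hα : 0 < α)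
    (hαγ : ∀ k, 2 - α - (U k).γ ≠ 0) (hc : 0 < c) : ∃ ω ∈ Ω U α, Gtilde ω < c := by
  have ht : Tendsto (fun l : ℝ => (∑ k, (U k).coef α) * l ^ (-(1 / α))) atTop (𝓝 0) := by
    simpa using (tendsto_rpow_neg_atTop (one_div_pos.2 hα)).const_mul (∑ k, (U k).coef α)
  obtain ⟨l, hlc, hl⟩ := ((ht.eventually (Iio_mem_nhds hc)).and (eventually_gt_atTop 0)).exists
  refine ⟨fun k => (-((U k).avg ((U k).threshold α l) (1 - α) / (1 - α)),
    (U k).avg ((U k).threshold α l) 1), fun k _ => subset_convexHull ℝ _ ?_, ?_⟩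
  · obtain ⟨T, hT, h1, h2⟩ := (U k).exists_isThreshold_finite (hαγ k) hl
    exact ⟨l, hl, T, hT, h1, h2⟩
  · simp only [Gtilde, fun k => (U k).avg_threshold (hαγ k) hl, ← Finset.sum_mul]
    exact hlc

/-! ### Identical users -/

theorem lamStar_of_coef_eq (U : Fin N → User) {α c C : ℝ} (hα : 0 < α) (hα1 : α ≠ 1)
    (hαγ : ∀ k, 2 - α - (U k).γ ≠ 0) (hc : 0 < c) (h : ∀ k, (U k).coef α = C) :
    lamStar U α c = (N * C / c) ^ α := by
  rw [lamStar_eq U hα hα1 hαγ hc]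
  simp [h]

theorem homogeneous_lamStar_of_ne (U : Fin N → User) {α c γ b : ℝ} (hα : 0 < α) (hα1 : α ≠ 1)
    (hαγ : ∀ k, 2 - α - (U k).γ ≠ 0) (hc : 0 < c) (h : ∀ k, (U k).γ = γ ∧ (U k).b = b)
    (hγ : γ ≠ 1) :
    lamStar U α c =
      (N : ℝ) ^ α / c ^ α * ((1 - γ) ^ α / (1 - b ^ (1 - γ)) ^ α) *
        ((1 - b ^ (2 - γ)) ^ α / (2 - γ) ^ α) *
        ((2 - γ) / (1 - b ^ (2 - γ))) * ((1 - b ^ (2 - α - γ)) / (2 - α - γ)) := by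
  rcases Nat.eq_zero_or_pos N with rfl | hN
  · rw [lamStar_eq U hα hα1 hαγ hc]
    simp [Real.zero_rpow hα.ne']
  obtain ⟨k, rfl, rfl⟩ : ∃ k, (U k).γ = γ ∧ (U k).b = b := ⟨⟨0, hN⟩, h _⟩
  have hcoef : ∀ j, (U j).coef α = (U k).coef α := fun j => by
    simp only [User.coef, (h j).1, (h j).2]
  rw [lamStar_of_coef_eq U hα hα1 hαγ hc hcoef]
  have e0 : 1 - (U k).γ ≠ 0 := sub_ne_zero.2 hγ.symm
  have e2 : 2 - (U k).γ ≠ 0 := by linarith [(U k).γ_mem.2]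
  have p0 : 0 < 1 - (U k).γ := lt_of_le_of_ne (sub_nonneg.2 (U k).γ_mem.2) e0.symm
  have p2 : 0 < 2 - (U k).γ := by linarith
  have g0 := (U k).powGap_pos (1 - (U k).γ)
  have g1 := (U k).powGap_pos (2 - α - (U k).γ)
  have g2 := (U k).powGap_pos (2 - (U k).γ)
  have q0 : 0 < 1 - (U k).b ^ (1 - (U k).γ) := by
    rw [powGap_of_ne _ e0] at g0; exact (div_pos_iff_of_pos_right p0).1 g0
  have q2 : 0 < 1 - (U k).b ^ (2 - (U k).γ) := by
    rw [powGap_of_ne _ e2] at g2; exact (div_pos_iff_of_pos_right p2).1 g2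
  have hC := (U k).coef_pos α
  rw [Real.div_rpow (by positivity) hc.le, Real.mul_rpow (Nat.cast_nonneg N) hC.le, User.coef,
    show 1 - α + 1 - (U k).γ = 2 - α - (U k).γ by ring,
    show (1 : ℝ) + 1 - (U k).γ = 2 - (U k).γ by ring,
    Real.mul_rpow (by positivity) (by positivity), ← Real.rpow_mul (by positivity),
    one_div_mul_cancel hα.ne', Real.rpow_one, ← powGap_of_ne _ (hαγ k), powGap_of_ne _ e0,
    powGap_of_ne _ e2, div_div_div_eq, Real.div_rpow (by positivity) (by positivity),
    Real.mul_rpow q2.le p0.le, Real.mul_rpow p2.le q0.le]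
  field_simp

theorem homogeneous_threshold (U : Fin N → User) {α c γ b : ℝ} (hα : 0 < α) (hα1 : α ≠ 1)
    (hαγ : ∀ k, 2 - α - (U k).γ ≠ 0) (hc : 0 < c) (h : ∀ k, (U k).γ = γ ∧ (U k).b = b)
    (hγ : γ ≠ 1) (k : Fin N) :
    (U k).threshold α (lamStar U α c) =
      c / N * ((1 - b ^ (1 - γ)) / (1 - γ)) * ((2 - γ) / (1 - b ^ (2 - γ))) := by
  obtain ⟨rfl, rfl⟩ := h k
  have hcoef : ∀ j, (U j).coef α = (U k).coef α := fun j => by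
    simp only [User.coef, (h j).1, (h j).2]
  have hN : (0 : ℝ) < N := Nat.cast_pos.2 k.pos
  have h1 := (U k).avg_threshold (hαγ k) (lamStar_pos U hα hα1 hαγ hc k)
  have hC := (U k).coef_pos α
  have e0 : 1 - (U k).γ ≠ 0 := sub_ne_zero.2 hγ.symm
  have e2 : 2 - (U k).γ ≠ 0 := by linarith [(U k).γ_mem.2]
  have g0 := (U k).powGap_pos (1 - (U k).γ)
  have g2 := (U k).powGap_pos (2 - (U k).γ)
  rw [lamStar_rpow U hα hα1 hαγ hc] at h1
  simp only [hcoef, Finset.sum_const, Finset.card_univ, Fintype.card_fin, nsmul_eq_mul] at h1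
  rw [User.avg, Real.rpow_one, show (1 : ℝ) + 1 - (U k).γ = 2 - (U k).γ by ring] at h1
  rw [← powGap_of_ne _ e0, ← inv_div (1 - (U k).b ^ (2 - (U k).γ)), ← powGap_of_ne _ e2]
  field_simp at h1 ⊢
  linarith

theorem homogeneous_lamStar_of_eq (U : Fin N → User) {α c γ b : ℝ} (hα : 0 < α) (hα1 : α ≠ 1)
    (hαγ : ∀ k, 2 - α - (U k).γ ≠ 0) (hc : 0 < c) (h : ∀ k, (U k).γ = γ ∧ (U k).b = b)
    (hγ : γ = 1) :
    lamStar U α c =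
      1 / c ^ α * (N * (((1 - b ^ (1 - α)) / ((1 - b) * (1 - α))) ^ (1 / α) *
        ((b - 1) / Real.log b))) ^ α := by
  subst hγ
  have hcoef : ∀ j, (U j).coef α
      = ((1 - b ^ (1 - α)) / ((1 - b) * (1 - α))) ^ (1 / α) * ((b - 1) / Real.log b) := by
    intro j
    obtain ⟨h1, rfl⟩ := h j
    rw [User.coef, h1, show 1 - α + 1 - 1 = 1 - α by ring, add_sub_cancel_right, sub_self,
      powGap_zero, powGap_of_ne _ one_ne_zero, Real.rpow_one, div_one,
      powGap_of_ne _ (sub_ne_zero.2 hα1.symm), div_div, mul_comm (1 - α), mul_comm,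
      div_neg, ← neg_div, neg_sub]
  have hnn : 0 ≤ N * (((1 - b ^ (1 - α)) / ((1 - b) * (1 - α))) ^ (1 / α) *
      ((b - 1) / Real.log b)) := by
    rcases Nat.eq_zero_or_pos N with rfl | hN
    · simp
    · rw [← hcoef ⟨0, hN⟩]
      exact mul_nonneg (Nat.cast_nonneg N) ((U _).coef_pos α).le
  rw [lamStar_of_coef_eq U hα hα1 hαγ hc hcoef, Real.div_rpow hnn hc.le, one_div_mul_eq_div]

end GAIMD

theorem mainTheorem1 (N : ℕ) (U : Fin N → GAIMD.User) (α c : ℝ) (hα : 0 < α) (hα1 : α ≠ 1)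
    (hαγ : ∀ k, 2 - α - (U k).γ ≠ 0) (hc : 0 < c) :
    -- (a) the threshold policies exist and have finite performances, and the reformulated problem is
    -- convex
    ((∀ k, ∀ l : ℝ, 0 < l → ∃ T : GAIMD.Policy,
        (U k).IsThreshold ((U k).threshold α l) T ∧
          ∃ p : ℝ × ℝ, -(U k).J α T.toMixed = (p.1 : EReal) ∧ (U k).G T.toMixed = (p.2 : EReal)) ∧
      Convex ℝ (GAIMD.Ω U α) ∧
      ConvexOn ℝ (GAIMD.Ω U α) GAIMD.negJtilde ∧
      ConvexOn ℝ (GAIMD.Ω U α) GAIMD.Gtilde) ∧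
    -- (b) Slater's condition
    (∃ ω ∈ GAIMD.Ω U α, GAIMD.Gtilde ω < c) ∧
    -- (c) the thresholds at `λ*` induce policies, and these are optimal
    ((∀ k, ∃! T : GAIMD.Policy,
        (U k).IsThreshold ((U k).threshold α (GAIMD.lamStar U α c)) T) ∧
      (∀ T : Fin N → GAIMD.Policy,
        (∀ k, (U k).IsThreshold ((U k).threshold α (GAIMD.lamStar U α c)) (T k)) →
          GAIMD.IsOptimal U α c fun k => (T k).toMixed)) ∧
    -- the homogeneous case
    (∀ γ b : ℝ, (∀ k, (U k).γ = γ ∧ (U k).b = b) →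
      (γ ≠ 1 →
        GAIMD.lamStar U α c =
          (N : ℝ) ^ α / c ^ α * ((1 - γ) ^ α / (1 - b ^ (1 - γ)) ^ α) *
            ((1 - b ^ (2 - γ)) ^ α / (2 - γ) ^ α) *
            ((2 - γ) / (1 - b ^ (2 - γ))) * ((1 - b ^ (2 - α - γ)) / (2 - α - γ)) ∧
        ∀ k, (U k).threshold α (GAIMD.lamStar U α c) =
          c / N * ((1 - b ^ (1 - γ)) / (1 - γ)) * ((2 - γ) / (1 - b ^ (2 - γ)))) ∧
      (γ = 1 →
        GAIMD.lamStar U α c =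
          1 / c ^ α * (N * (((1 - b ^ (1 - α)) / ((1 - b) * (1 - α))) ^ (1 / α) *
            ((b - 1) / Real.log b))) ^ α)) := by
  refine ⟨⟨fun k l hl => ?_, GAIMD.Ω_convex U α, GAIMD.negJtilde_convexOn (GAIMD.Ω_convex U α),
    GAIMD.Gtilde_convexOn (GAIMD.Ω_convex U α)⟩, GAIMD.exists_mem_Ω_Gtilde_lt U hα hαγ hc,
    ⟨fun k => (U k).existsUnique_isThreshold
      ((U k).threshold_pos (hαγ k) (GAIMD.lamStar_pos U hα hα1 hαγ hc k)), fun T hT => ?_⟩,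
    fun γ b h => ⟨fun hγ => ⟨GAIMD.homogeneous_lamStar_of_ne U hα hα1 hαγ hc h hγ,
      GAIMD.homogeneous_threshold U hα hα1 hαγ hc h hγ⟩,
      GAIMD.homogeneous_lamStar_of_eq U hα hα1 hαγ hc h⟩⟩
  · obtain ⟨T, hT, h1, h2⟩ := (U k).exists_isThreshold_finite (hαγ k) hl
    exact ⟨T, hT, (_, _), h1, h2⟩
  · rcases Nat.eq_zero_or_pos N with rfl | hN
    · -- Without users the multiplier is `0` and there is nothing to optimize.
      simp [GAIMD.IsOptimal, GAIMD.totalG, GAIMD.totalJ, hc.le]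
    · exact GAIMD.isOptimal_of_sum_avg_eq U hα hα1 hαγ
        (GAIMD.lamStar_pos U hα hα1 hαγ hc ⟨0, hN⟩)
        (GAIMD.sum_avg_lamStar U hα hα1 hαγ hc ⟨0, hN⟩) hT
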